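/- For every $C>0$, the positive spectrum of the operator $T=\partial_{tt}+Ce^{-|t|}$ on the complex Hilbert space $L^2(\mathbb R)$ is finite. That is, the set $\sigma(T)\cap(0,\infty)$ is a finite set. Here $T$ has the domain $D=\{f\in H^1_0(\mathbb R) : \partial_{tt}f\in L^2(\mathbb R)\}$, where $\partial_{tt}f$ is the second derivative in the sense of distributions and $H^1_0(\mathbb R)$ is the completion of $C_c^\infty(\mathbb R)$ under the norm $\|f\|_{L^2}+\|f'\|_{L^2}$. The spectrum $\sigma(T)$ is the set of $z\in\mathbb C$ for which $T-z:D\to L^2(\mathbb R)$ has no bounded everywhere defined inverse. -/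

import Mathlib

open MeasureTheory
open scoped ContDiff ENNReal

noncomputable section

/-- The complex Hilbert space `L²(ℝ)` for Lebesgue measure. -/
abbrev L2R : Type := Lp ℂ 2 (volume : Measure ℝ)

/-- Smooth compactly supported complex-valued functions on `ℝ`. -/
def IsTestFun (φ : ℝ → ℂ) : Prop := ContDiff ℝ ∞ φ ∧ HasCompactSupport φ

theorem IsTestFun.deriv {φ : ℝ → ℂ} (h : IsTestFun φ) : IsTestFun (deriv φ) :=
  ⟨(contDiff_infty_iff_deriv.mp h.1).2, h.2.deriv⟩

theorem IsTestFun.memLp {φ : ℝ → ℂ} (h : IsTestFun φ) (p : ℝ≥0∞) :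
    MemLp φ p (volume : Measure ℝ) :=
  h.1.continuous.memLp_of_hasCompactSupport h.2

theorem IsTestFun.integrable_mul {φ : ℝ → ℂ} (h : IsTestFun φ) (f : L2R) :
    Integrable (fun t => f t * φ t) (volume : Measure ℝ) :=
  (Lp.memLp f).integrable_mul (h.memLp 2)

/-- The pairs `(φ, φ')` in `L² × L²`, for `φ` a test function. -/
def testGraph : Submodule ℂ (L2R × L2R) where
  carrier := {p | ∃ φ : ℝ → ℂ, IsTestFun φ ∧ p.1 =ᵐ[volume] φ ∧ p.2 =ᵐ[volume] deriv φ}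
  zero_mem' := by
    refine ⟨0, ⟨contDiff_const, HasCompactSupport.zero⟩, Lp.coeFn_zero _ _ _, ?_⟩
    have : deriv (0 : ℝ → ℂ) = 0 := by ext t; simp
    rw [this]
    exact Lp.coeFn_zero _ _ _
  add_mem' := by
    rintro p q ⟨φ, hφ, h1, h2⟩ ⟨ψ, hψ, h3, h4⟩
    refine ⟨φ + ψ, ⟨hφ.1.add hψ.1, hφ.2.add hψ.2⟩, (Lp.coeFn_add _ _).trans (h1.add h3), ?_⟩
    have : deriv (φ + ψ) = deriv φ + deriv ψ := by
      ext t
      exact deriv_add (hφ.1.differentiable (by simp) t) (hψ.1.differentiable (by simp) t)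
    rw [this]
    exact (Lp.coeFn_add _ _).trans (h2.add h4)
  smul_mem' := by
    rintro c p ⟨φ, hφ, h1, h2⟩
    refine ⟨c • φ, ⟨contDiff_const.smul hφ.1, hφ.2.smul_left (f := fun _ => c)⟩,
      (Lp.coeFn_smul _ _).trans (h1.const_smul c), ?_⟩
    have : deriv (c • φ) = c • deriv φ := by
      ext t
      exact deriv_const_smul c (hφ.1.differentiable (by simp) t)
    rw [this]
    exact (Lp.coeFn_smul _ _).trans (h2.const_smul c)

/-- `H¹₀(ℝ)`, the completion of the test functions for `‖φ‖_{L²} + ‖φ'‖_{L²}`, realised inside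
`L²(ℝ)`: the `f` for which there are test functions `φₙ` with `φₙ → f` in `L²` and `φₙ'`
convergent in `L²`. -/
def sobolevH10 : Submodule ℂ L2R :=
  testGraph.topologicalClosure.map (LinearMap.fst ℂ L2R L2R)

/-- `g` is the second derivative of `f` in the sense of distributions. -/
def HasWeakSecondDeriv (f g : L2R) : Prop :=
  ∀ φ : ℝ → ℂ, IsTestFun φ → ∫ t, f t * deriv (deriv φ) t = ∫ t, g t * φ t

theorem integral_add_mul (f g : L2R) {φ : ℝ → ℂ} (hφ : IsTestFun φ) :
    ∫ t, (f + g : L2R) t * φ t = (∫ t, f t * φ t) + ∫ t, g t * φ t := by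
  rw [← integral_add (hφ.integrable_mul f) (hφ.integrable_mul g)]
  refine integral_congr_ae ?_
  filter_upwards [Lp.coeFn_add f g] with t ht
  rw [ht, Pi.add_apply, add_mul]

theorem integral_smul_mul (c : ℂ) (f : L2R) (φ : ℝ → ℂ) :
    ∫ t, (c • f : L2R) t * φ t = c * ∫ t, f t * φ t := by
  rw [← integral_const_mul]
  refine integral_congr_ae ?_
  filter_upwards [Lp.coeFn_smul c f] with t ht
  rw [ht, Pi.smul_apply, smul_eq_mul, mul_assoc]

theorem integral_zero_mul (φ : ℝ → ℂ) : ∫ t, (0 : L2R) t * φ t = 0 := by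
  simpa only [zero_smul, zero_mul] using integral_smul_mul 0 0 φ

/-- The graph of `∂_tt`: the pairs `(f, f'')` with `f ∈ H¹₀(ℝ)` and `f'' ∈ L²(ℝ)`. -/
def laplacianGraph : Submodule ℂ (L2R × L2R) where
  carrier := {p | p.1 ∈ sobolevH10 ∧ HasWeakSecondDeriv p.1 p.2}
  zero_mem' := by
    refine ⟨sobolevH10.zero_mem, fun φ _ => ?_⟩
    exact (integral_zero_mul _).trans (integral_zero_mul _).symm
  add_mem' := by
    rintro p q ⟨h1, h2⟩ ⟨h3, h4⟩
    refine ⟨sobolevH10.add_mem h1 h3, fun φ hφ => ?_⟩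
    rw [Prod.fst_add, Prod.snd_add, integral_add_mul _ _ hφ.deriv.deriv, integral_add_mul _ _ hφ,
      h2 φ hφ, h4 φ hφ]
  smul_mem' := by
    rintro c p ⟨h1, h2⟩
    refine ⟨sobolevH10.smul_mem c h1, fun φ hφ => ?_⟩
    rw [Prod.smul_fst, Prod.smul_snd, integral_smul_mul, integral_smul_mul, h2 φ hφ]

/-- The second derivative is unique, so that `laplacianGraph` is the graph of an operator. -/
theorem laplacianGraph_snd_eq_zero (p : L2R × L2R) (hp : p ∈ laplacianGraph) (h0 : p.1 = 0) :
    p.2 = 0 := by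
  have hloc : LocallyIntegrable (p.2 : ℝ → ℂ) (volume : Measure ℝ) :=
    (Lp.memLp p.2).locallyIntegrable (by norm_num)
  refine (Lp.eq_zero_iff_ae_eq_zero).mpr ?_
  refine ae_eq_zero_of_integral_contDiff_smul_eq_zero hloc fun g hg hgs => ?_
  have hφ : IsTestFun (fun t => (g t : ℂ)) :=
    ⟨Complex.ofRealCLM.contDiff.comp hg, hgs.comp_left (g := Complex.ofReal) Complex.ofReal_zero⟩
  have key := hp.2 _ hφ
  rw [h0, integral_zero_mul] at key
  rw [key]
  refine integral_congr_ae (Filter.Eventually.of_forall fun t => ?_)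
  simp [mul_comm]

/-- The operator `Δ = ∂_tt` on `L²(ℝ)` with domain `{f ∈ H¹₀(ℝ) | Δ f ∈ L²(ℝ)}`. -/
def laplacianR : L2R →ₗ.[ℂ] L2R := laplacianGraph.toLinearPMap

theorem laplacianR_graph : laplacianR.graph = laplacianGraph :=
  laplacianGraph.toLinearPMap_graph_eq laplacianGraph_snd_eq_zero

theorem memLp_expPotential_mul (C : ℝ) (f : L2R) :
    MemLp (fun t : ℝ => ((C * Real.exp (-|t|) : ℝ) : ℂ) * f t) 2 volume := by
  refine MemLp.of_le_mul (c := |C|) (Lp.memLp f) ?_ (Filter.Eventually.of_forall fun t => ?_)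
  · exact (Continuous.aestronglyMeasurable (by fun_prop)).mul (Lp.aestronglyMeasurable f)
  · have h1 : Real.exp (-|t|) ≤ 1 := Real.exp_le_one_iff.mpr (by simp)
    rw [norm_mul, Complex.norm_real, norm_mul, Real.norm_eq_abs, Real.norm_eq_abs, Real.abs_exp]
    gcongr
    exact mul_le_of_le_one_right (abs_nonneg C) h1

/-- Multiplication by the function `t ↦ C e^{-|t|}` on `L²(ℝ)`. -/
def expPotential (C : ℝ) : L2R →ₗ[ℂ] L2R where
  toFun f := (memLp_expPotential_mul C f).toLp
  map_add' f g := by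
    rw [← MemLp.toLp_add]
    refine MemLp.toLp_congr _ _ ?_
    filter_upwards [Lp.coeFn_add f g] with t ht
    simp only [ht, Pi.add_apply, mul_add]
  map_smul' c f := by
    rw [RingHom.id_apply, ← MemLp.toLp_const_smul]
    refine MemLp.toLp_congr _ _ ?_
    filter_upwards [Lp.coeFn_smul c f] with t ht
    simp only [ht, Pi.smul_apply, smul_eq_mul]
    ring

/-- The operator `∂_tt + C e^{-|t|}` on `L²(ℝ)`, with the domain of `∂_tt`. -/
def laplacianAddExp (C : ℝ) : L2R →ₗ.[ℂ] L2R := expPotential C +ᵥ laplacianR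

/-- The resolvent set of an unbounded operator `T`: the `z` for which `T - z`, as a map from the
domain of `T` to `H`, has an everywhere defined bounded two-sided inverse. -/
def unboundedResolventSet {H : Type*} [NormedAddCommGroup H] [NormedSpace ℂ H]
    (T : H →ₗ.[ℂ] H) : Set ℂ :=
  {z | ∃ R : H →L[ℂ] H,
    (∀ x : T.domain, R (T x - z • (x : H)) = x) ∧
    (∀ y : H, ∃ x : T.domain, (x : H) = R y ∧ T x - z • (x : H) = y)}

/-- The spectrum of an unbounded operator. -/
def unboundedSpectrum {H : Type*} [NormedAddCommGroup H] [NormedSpace ℂ H]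
    (T : H →ₗ.[ℂ] H) : Set ℂ :=
  (unboundedResolventSet T)ᶜ

end

/-! Write a positive spectral parameter as `μ ^ 2` with `μ > 0`. On `t ≥ 0` the equation `u'' = (μ²
- C e^{-t}) u` has an explicit decaying (Jost) solution, a power series in `e^{-t}` times `e^{-μ
t}`. The potential is even, so an eigenfunction should be an even or odd extension of `u`, which
requires `u'(0) = 0` or `u(0) = 0`. The spectrum in `(0, ∞)` is thus confined to the squares of the
positive zeros of `jostProduct`.

These zeros are finite in number (`finite_setOf_jostProduct_eq_zero`). The product is holomorphic on
`Re μ > -1/4`, a neighbourhood of `μ = 0`, and has no zeros for large real `μ`. Infinitely many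
positive zeros would accumulate in a compact segment, possibly at `0`, but still inside the domain,
against the identity theorem.

If the product is nonzero, `μ²` is a resolvent point. Wronskians with `u` on the two half-lines
control the data at `0` of a test function by its image under `T - μ²`; a growth bound near `0` and
an energy estimate further out then control its `L²` norm
(`exists_integral_sq_le_of_jostDeriv_ne_zero`). Test functions are a core
(`HasWeakSecondDeriv.mem_closure_testSecondDerivGraph`), so the bound holds on the whole domain.
Applied to weak solutions of the adjoint equation, it also gives density of the range, hence
surjectivity. -/

noncomputable section

open scoped InnerProductSpace ComplexConjugate

/-! ### Closed graphs and a resolvent criterion -/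

section GraphClosure

variable {E F : Type*} [NormedAddCommGroup E] [NormedSpace ℂ E]
  [NormedAddCommGroup F] [NormedSpace ℂ F]

/-- If the first component of the elements of `P` is controlled by the second, then the second
projection maps the closure of `P` onto the closure of its image. -/
theorem exists_mem_topologicalClosure_of_norm_fst_le [CompleteSpace E]
    {P : Submodule ℂ (E × F)} {K : ℝ} (hK : ∀ p ∈ P, ‖p.1‖ ≤ K * ‖p.2‖) {y : F}
    (hy : y ∈ (P.map (LinearMap.snd ℂ E F)).topologicalClosure) :
    ∃ x, (x, y) ∈ P.topologicalClosure := by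
  obtain ⟨u, hu, hlim⟩ := mem_closure_iff_seq_limit.mp hy
  choose p hp hpu using hu
  have hpu' : ∀ n, (p n).2 = u n := hpu
  have hcauchy : CauchySeq fun n => (p n).1 := by
    have hu0 : CauchySeq u := hlim.cauchySeq
    rw [Metric.cauchySeq_iff'] at hu0 ⊢
    intro ε hε
    obtain ⟨N, hN⟩ := hu0 (ε / (|K| + 1)) (by positivity)
    refine ⟨N, fun n hn => ?_⟩
    have h1 := hK _ (P.sub_mem (hp n) (hp N))
    have h2 := hN n hn
    rw [dist_eq_norm, lt_div_iff₀ (by positivity)] at h2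
    rw [Prod.fst_sub, Prod.snd_sub, hpu', hpu'] at h1
    rw [dist_eq_norm]
    have h3 : K * ‖u n - u N‖ ≤ |K| * ‖u n - u N‖ :=
      mul_le_mul_of_nonneg_right (le_abs_self K) (norm_nonneg _)
    nlinarith [norm_nonneg (u n - u N)]
  obtain ⟨x, hx⟩ := cauchySeq_tendsto_of_complete hcauchy
  refine ⟨x, mem_closure_iff_seq_limit.mpr ⟨p, hp, ?_⟩⟩
  rw [nhds_prod_eq]
  refine hx.prodMk ?_
  simpa only [hpu'] using hlim

end GraphClosure

/-- The lower bound gives injectivity and is itself the norm bound on the inverse, so closedness of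
`T` is not needed. -/
theorem mem_unboundedResolventSet_of_norm_le {H : Type*} [NormedAddCommGroup H] [NormedSpace ℂ H]
    (T : H →ₗ.[ℂ] H) (z : ℂ) (K : ℝ) (hK : ∀ x : T.domain, ‖(x : H)‖ ≤ K * ‖T x - z • (x : H)‖)
    (hsurj : ∀ y : H, ∃ x : T.domain, T x - z • (x : H) = y) :
    z ∈ unboundedResolventSet T := by
  let S : T.domain →ₗ[ℂ] H := T.toFun - z • T.domain.subtype
  have hS : ∀ x, S x = T x - z • (x : H) := fun x => rfl
  have hinj : Function.Injective S := by
    rw [injective_iff_map_eq_zero]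
    intro x hx
    have := hK x
    rw [← hS, hx, norm_zero, mul_zero] at this
    exact Subtype.ext (norm_le_zero_iff.mp this)
  let e : T.domain ≃ₗ[ℂ] H := LinearEquiv.ofBijective S ⟨hinj, fun y => hsurj y⟩
  have he : ∀ x, e x = T x - z • (x : H) := fun x => rfl
  refine ⟨(T.domain.subtype ∘ₗ e.symm.toLinearMap).mkContinuous K fun y => ?_, fun x => ?_,
    fun y => ⟨e.symm y, rfl, ?_⟩⟩
  · have := hK (e.symm y)
    rwa [← he, e.apply_symm_apply] at this
  · rw [← he]
    exact congrArg Subtype.val (e.symm_apply_apply x)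
  · rw [← he, e.apply_symm_apply]

/-! ### Test functions in `L²` and integration by parts -/

theorem IsTestFun.conj {φ : ℝ → ℂ} (h : IsTestFun φ) : IsTestFun (fun t => conj (φ t)) :=
  ⟨Complex.conjCLE.contDiff.comp h.1, h.2.comp_left (g := conj) (map_zero _)⟩

theorem IsTestFun.hasDerivAt {φ : ℝ → ℂ} (h : IsTestFun φ) (t : ℝ) :
    HasDerivAt φ (_root_.deriv φ t) t :=
  (h.1.differentiable (by simp) t).hasDerivAt

theorem IsTestFun.deriv_conj {φ : ℝ → ℂ} (h : IsTestFun φ) :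
    _root_.deriv (fun t => conj (φ t)) = fun t => conj (_root_.deriv φ t) := by
  ext t
  exact (Complex.conjCLE.hasFDerivAt.comp_hasDerivAt t (h.hasDerivAt t)).deriv

theorem IsTestFun.integrable_mul_testFun {φ ψ : ℝ → ℂ} (h : IsTestFun φ) (hψ : IsTestFun ψ) :
    Integrable (fun t => φ t * ψ t) (volume : Measure ℝ) :=
  (h.memLp 2).integrable_mul (hψ.memLp 2)

theorem IsTestFun.integral_mul_deriv {φ ψ : ℝ → ℂ} (h : IsTestFun φ) (hψ : IsTestFun ψ) :
    ∫ t, φ t * _root_.deriv ψ t = -∫ t, _root_.deriv φ t * ψ t :=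
  integral_mul_deriv_eq_deriv_mul_of_integrable (fun t _ => h.hasDerivAt t)
    (fun t _ => hψ.hasDerivAt t) (h.integrable_mul_testFun hψ.deriv)
    (h.deriv.integrable_mul_testFun hψ) (h.integrable_mul_testFun hψ)

/-- A test function as an element of `L²(ℝ)`. -/
def IsTestFun.toL2 {φ : ℝ → ℂ} (h : IsTestFun φ) : L2R := (h.memLp 2).toLp φ

theorem IsTestFun.coeFn_toL2 {φ : ℝ → ℂ} (h : IsTestFun φ) : h.toL2 =ᵐ[volume] φ :=
  MemLp.coeFn_toLp _

theorem IsTestFun.integral_toL2_mul {φ : ℝ → ℂ} (h : IsTestFun φ) (ψ : ℝ → ℂ) :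
    ∫ t, h.toL2 t * ψ t = ∫ t, φ t * ψ t := by
  refine integral_congr_ae ?_
  filter_upwards [h.coeFn_toL2] with t ht
  rw [ht]

theorem inner_eq_integral_star_mul (f g : L2R) {φ : ℝ → ℂ} (hg : g =ᵐ[volume] φ) :
    ⟪f, g⟫_ℂ = ∫ t, (star f : L2R) t * φ t := by
  rw [L2.inner_def]
  refine integral_congr_ae ?_
  filter_upwards [Lp.coeFn_star f, hg] with t ht hgt
  rw [ht, hgt, RCLike.inner_apply, Pi.star_apply, mul_comm]
  rfl

theorem IsTestFun.integral_mul_eq_inner {φ : ℝ → ℂ} (h : IsTestFun φ) (f : L2R) :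
    ∫ t, f t * φ t = ⟪h.conj.toL2, f⟫_ℂ := by
  rw [L2.inner_def]
  refine integral_congr_ae ?_
  filter_upwards [h.conj.coeFn_toL2] with t ht
  rw [ht, RCLike.inner_apply, Complex.conj_conj]

theorem IsTestFun.inner_toL2 {φ ψ : ℝ → ℂ} (h : IsTestFun φ) (hψ : IsTestFun ψ) :
    ⟪h.toL2, hψ.toL2⟫_ℂ = ∫ t, conj (φ t) * ψ t := by
  rw [L2.inner_def]
  refine integral_congr_ae ?_
  filter_upwards [h.coeFn_toL2, hψ.coeFn_toL2] with t ht hψt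
  rw [ht, hψt, RCLike.inner_apply, mul_comm]

theorem IsTestFun.inner_deriv_deriv {φ : ℝ → ℂ} (h : IsTestFun φ) :
    ⟪h.toL2, h.deriv.deriv.toL2⟫_ℂ = -(‖h.deriv.toL2‖ ^ 2 : ℝ) := by
  have h1 := h.conj.integral_mul_deriv h.deriv
  rw [h.deriv_conj, ← h.deriv.inner_toL2 h.deriv, ← h.inner_toL2 h.deriv.deriv,
    inner_self_eq_norm_sq_to_K] at h1
  rw [h1]
  push_cast
  rfl

/-- Cauchy–Schwarz in `‖φ'‖² = -⟪φ, φ''⟫`. The maximum is the product norm of `(φ, φ'')`, so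
convergence of these pairs forces convergence of `φ'`. -/
theorem IsTestFun.norm_deriv_le {φ : ℝ → ℂ} (h : IsTestFun φ) :
    ‖h.deriv.toL2‖ ≤ max ‖h.toL2‖ ‖h.deriv.deriv.toL2‖ := by
  have h1 : ‖h.deriv.toL2‖ ^ 2 ≤ ‖h.toL2‖ * ‖h.deriv.deriv.toL2‖ := by
    have h2 := norm_inner_le_norm (𝕜 := ℂ) h.toL2 h.deriv.deriv.toL2
    rw [h.inner_deriv_deriv, norm_neg, Complex.norm_real, Real.norm_eq_abs, abs_sq] at h2
    exact h2
  refine le_of_sq_le_sq ?_ (le_max_of_le_left (norm_nonneg _))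
  refine h1.trans ?_
  rw [sq]
  exact mul_le_mul (le_max_left _ _) (le_max_right _ _) (norm_nonneg _)
    (le_max_of_le_left (norm_nonneg _))

/-- Pairing with `φ` gives `-(‖φ'‖² + ‖φ‖²)`. This is the lower bound for `∂_tt - 1` behind the core
property. -/
theorem IsTestFun.norm_le_norm_deriv_deriv_sub {φ : ℝ → ℂ} (h : IsTestFun φ) :
    ‖h.toL2‖ ≤ ‖h.deriv.deriv.toL2 - h.toL2‖ := by
  have h1 : ⟪h.toL2, h.deriv.deriv.toL2 - h.toL2⟫_ℂ
      = -((‖h.deriv.toL2‖ ^ 2 + ‖h.toL2‖ ^ 2 : ℝ) : ℂ) := by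
    rw [inner_sub_right, h.inner_deriv_deriv, inner_self_eq_norm_sq_to_K]
    push_cast
    ring_nf
    rfl
  have h2 := norm_inner_le_norm (𝕜 := ℂ) h.toL2 (h.deriv.deriv.toL2 - h.toL2)
  rw [h1, norm_neg, Complex.norm_real, Real.norm_eq_abs, abs_of_nonneg (by positivity)] at h2
  rcases (norm_nonneg h.toL2).eq_or_lt with h0 | h0
  · rw [← h0]
    exact norm_nonneg _
  · nlinarith [sq_nonneg ‖h.deriv.toL2‖]

/-! ### The closure of `∂_tt` on test functions -/

/-- The triples `(φ', (φ, φ''))` in `L² × (L² × L²)`, for `φ` a test function. -/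
def testJet : Submodule ℂ (L2R × L2R × L2R) where
  carrier := {p | ∃ (φ : ℝ → ℂ) (h : IsTestFun φ),
    p = (h.deriv.toL2, h.toL2, h.deriv.deriv.toL2)}
  zero_mem' := by
    have h0 : IsTestFun 0 := ⟨contDiff_const, HasCompactSupport.zero⟩
    have hd : deriv (0 : ℝ → ℂ) = 0 := by ext t; simp
    refine ⟨0, h0, ?_⟩
    have key : ∀ (ψ : ℝ → ℂ) (h : IsTestFun ψ), ψ = 0 → (0 : L2R) = h.toL2 := by
      rintro _ h rfl
      exact (MemLp.toLp_zero _).symm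
    exact Prod.ext (key _ h0.deriv hd) (Prod.ext (key _ h0 rfl)
      (key _ h0.deriv.deriv (by rw [hd, hd])))
  add_mem' := by
    rintro _ _ ⟨φ, h, rfl⟩ ⟨ψ, hψ, rfl⟩
    have key : ∀ {φ ψ χ : ℝ → ℂ} (h : IsTestFun φ) (hψ : IsTestFun ψ) (hχ : IsTestFun χ),
        χ = φ + ψ → h.toL2 + hψ.toL2 = hχ.toL2 := by
      rintro φ ψ _ h hψ hχ rfl
      exact (MemLp.toLp_add _ _).symm
    have hs : ∀ {φ ψ : ℝ → ℂ}, IsTestFun φ → IsTestFun ψ → deriv (φ + ψ) = deriv φ + deriv ψ :=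
      fun h hψ => funext fun t => ((h.hasDerivAt t).add (hψ.hasDerivAt t)).deriv
    have h1 := hs h hψ
    have h2 : IsTestFun (φ + ψ) := ⟨h.1.add hψ.1, h.2.add hψ.2⟩
    refine ⟨φ + ψ, h2, ?_⟩
    exact Prod.ext (key h.deriv hψ.deriv h2.deriv h1) (Prod.ext (key h hψ h2 rfl)
      (key h.deriv.deriv hψ.deriv.deriv h2.deriv.deriv (by rw [h1, hs h.deriv hψ.deriv])))
  smul_mem' := by
    rintro c _ ⟨φ, h, rfl⟩
    have key : ∀ {φ χ : ℝ → ℂ} (h : IsTestFun φ) (hχ : IsTestFun χ),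
        χ = c • φ → c • h.toL2 = hχ.toL2 := by
      rintro φ _ h hχ rfl
      exact (MemLp.toLp_const_smul _ _).symm
    have hs : ∀ {φ : ℝ → ℂ}, IsTestFun φ → deriv (c • φ) = c • deriv φ :=
      fun h => funext fun t => ((h.hasDerivAt t).const_smul c).deriv
    have h1 := hs h
    have h2 : IsTestFun (c • φ) :=
      ⟨contDiff_const.smul h.1, h.2.smul_left (f := fun _ => c)⟩
    refine ⟨c • φ, h2, ?_⟩
    exact Prod.ext (key h.deriv h2.deriv h1) (Prod.ext (key h h2 rfl)
      (key h.deriv.deriv h2.deriv.deriv (by rw [h1, hs h.deriv])))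

/-- The pairs `(φ, φ'')` in `L² × L²`, for `φ` a test function. -/
def testSecondDerivGraph : Submodule ℂ (L2R × L2R) :=
  testJet.map (LinearMap.snd ℂ L2R (L2R × L2R))

theorem IsTestFun.mem_testSecondDerivGraph {φ : ℝ → ℂ} (h : IsTestFun φ) :
    (h.toL2, h.deriv.deriv.toL2) ∈ testSecondDerivGraph :=
  ⟨_, ⟨φ, h, rfl⟩, rfl⟩

theorem exists_of_mem_testSecondDerivGraph {p : L2R × L2R} (hp : p ∈ testSecondDerivGraph) :
    ∃ (φ : ℝ → ℂ) (h : IsTestFun φ), p = (h.toL2, h.deriv.deriv.toL2) := by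
  obtain ⟨_, ⟨φ, h, rfl⟩, rfl⟩ := hp
  exact ⟨φ, h, rfl⟩

theorem isClosed_hasWeakSecondDeriv :
    IsClosed {p : L2R × L2R | HasWeakSecondDeriv p.1 p.2} := by
  simp only [HasWeakSecondDeriv, Set.ofPred_forall]
  refine isClosed_iInter fun φ => isClosed_iInter fun h => ?_
  simp only [h.deriv.deriv.integral_mul_eq_inner, h.integral_mul_eq_inner]
  exact isClosed_eq (by fun_prop) (by fun_prop)

theorem IsTestFun.hasWeakSecondDeriv {φ : ℝ → ℂ} (h : IsTestFun φ) :
    HasWeakSecondDeriv h.toL2 h.deriv.deriv.toL2 := by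
  intro ψ hψ
  rw [h.integral_toL2_mul, h.deriv.deriv.integral_toL2_mul, h.integral_mul_deriv hψ.deriv,
    h.deriv.integral_mul_deriv hψ, neg_neg]

/-- Along a convergent sequence of pairs `(φ, φ'')` the derivatives `φ'` converge too, which puts
the limit in `H¹₀`. The weak equation passes to limits because each test pairing is continuous on
`L²`. -/
theorem closure_testSecondDerivGraph_le : testSecondDerivGraph.topologicalClosure ≤ laplacianGraph := by
  rintro ⟨x, y⟩ hp
  refine ⟨?_, ?_⟩
  · have hK : ∀ p ∈ testJet, ‖p.1‖ ≤ 1 * ‖p.2‖ := by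
      rintro _ ⟨φ, h, rfl⟩
      rw [one_mul, Prod.norm_def]
      exact h.norm_deriv_le
    obtain ⟨q, hq⟩ := exists_mem_topologicalClosure_of_norm_fst_le hK hp
    refine ⟨(x, q), ?_, rfl⟩
    refine map_mem_closure (f := fun p : L2R × L2R × L2R => (p.2.1, p.1)) (by fun_prop) hq ?_
    rintro _ ⟨φ, h, rfl⟩
    exact ⟨φ, h, h.coeFn_toL2, h.deriv.coeFn_toL2⟩
  · refine closure_minimal ?_ isClosed_hasWeakSecondDeriv hp
    intro p hp
    obtain ⟨φ, h, rfl⟩ := exists_of_mem_testSecondDerivGraph hp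
    exact h.hasWeakSecondDeriv

/-- Solvability of `x'' + B x = y` in the closure of the test functions, from a lower bound and
the density of the range. -/
theorem exists_mem_closure_testSecondDerivGraph (B : L2R →L[ℂ] L2R) {K : ℝ}
    (hK : ∀ p ∈ testSecondDerivGraph, ‖p.1‖ ≤ K * ‖p.2 + B p.1‖)
    (hd : ∀ y : L2R, (∀ p ∈ testSecondDerivGraph, ⟪y, p.2 + B p.1⟫_ℂ = 0) → y = 0) (y : L2R) :
    ∃ x, (x, y - B x) ∈ testSecondDerivGraph.topologicalClosure := by
  -- A shear with continuous inverse `(x, z) ↦ (x, z - B x)`: it makes `x'' + B x` the second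
  -- coordinate and is undone after taking closures.
  let S : L2R × L2R →ₗ[ℂ] L2R × L2R :=
    (LinearMap.fst ℂ L2R L2R).prod
      (LinearMap.snd ℂ L2R L2R + B.toLinearMap ∘ₗ LinearMap.fst ℂ L2R L2R)
  have hS : ∀ p, S p = (p.1, p.2 + B p.1) := fun p => rfl
  let P := testSecondDerivGraph.map S
  have hPK : ∀ p ∈ P, ‖p.1‖ ≤ K * ‖p.2‖ := by
    rintro _ ⟨p, hp, rfl⟩
    exact hK p hp
  have htop : (P.map (LinearMap.snd ℂ L2R L2R)).topologicalClosure = ⊤ := by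
    rw [Submodule.topologicalClosure_eq_top_iff, Submodule.eq_bot_iff]
    intro z hz
    refine hd z fun p hp => ?_
    exact (Submodule.mem_orthogonal' _ _).mp hz _ ⟨S p, ⟨p, hp, rfl⟩, rfl⟩
  obtain ⟨x, hx⟩ := exists_mem_topologicalClosure_of_norm_fst_le hPK
    (y := y) (by rw [htop]; trivial)
  refine ⟨x, ?_⟩
  refine map_mem_closure (f := fun p : L2R × L2R => (p.1, p.2 - B p.1)) (by fun_prop) hx ?_
  rintro _ ⟨p, hp, rfl⟩
  have : (p.1, p.2 + B p.1 - B p.1) = p := Prod.ext rfl (add_sub_cancel_right _ _)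
  change (p.1, p.2 + B p.1 - B p.1) ∈ testSecondDerivGraph
  rwa [this]

/-! ### Uniqueness for `y'' = y` and the core property -/

theorem eq_zero_of_exp_mul_norm_le {a : ℂ} {c : ℝ} (h : ∀ t : ℝ, 0 ≤ t → Real.exp t * ‖a‖ ≤ c) :
    a = 0 := by
  by_contra ha
  have ha' : 0 < ‖a‖ := norm_pos_iff.mpr ha
  have hc : 0 ≤ c := (by positivity : 0 ≤ Real.exp 0 * ‖a‖).trans (h 0 le_rfl)
  have h1 := h (c / ‖a‖) (by positivity)
  have h2 := Real.add_one_le_exp (c / ‖a‖)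
  have h3 : (c / ‖a‖ + 1) * ‖a‖ = c + ‖a‖ := by field_simp
  nlinarith

theorem eq_exp_mul_of_hasDerivAt {Z : ℝ → ℂ} {r : ℝ} (h : ∀ t, HasDerivAt Z (r * Z t) t) (t : ℝ) :
    Z t = Real.exp (r * t) * Z 0 := by
  have hd : ∀ s, HasDerivAt (fun s => (Real.exp (-(r * s)) : ℂ) * Z s) 0 s := by
    intro s
    have h1 : HasDerivAt (fun s => Real.exp (-(r * s))) (Real.exp (-(r * s)) * -(r * 1)) s :=
      (((hasDerivAt_id s).const_mul r).neg).exp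
    refine (h1.ofReal_comp.mul (h s)).congr_deriv ?_
    push_cast
    ring
  have h1 := is_const_of_deriv_eq_zero (fun s => (hd s).differentiableAt) (fun s => (hd s).deriv) t 0
  simp only [mul_zero, neg_zero, Real.exp_zero, Complex.ofReal_one, one_mul] at h1
  rw [← h1, ← mul_assoc, ← Complex.ofReal_mul, ← Real.exp_add]
  simp

/-- A bounded solution of `Y'' = Y` vanishes. -/
theorem eq_zero_of_hasDerivAt_of_bounded {Y Y' : ℝ → ℂ} {M : ℝ} (h : ∀ t, HasDerivAt Y (Y' t) t)
    (h' : ∀ t, HasDerivAt Y' (Y t) t) (hM : ∀ t, ‖Y t‖ ≤ M) : Y 0 = 0 := by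
  -- `Y + Y'` and `Y - Y'` are multiples of `e^t` and `e^{-t}`. Boundedness at `+∞` kills the first
  -- and at `-∞` the second.
  have hz := eq_exp_mul_of_hasDerivAt (Z := fun t => Y t + Y' t) (r := 1) fun t => by
    refine ((h t).add (h' t)).congr_deriv ?_
    push_cast
    ring
  have hw := eq_exp_mul_of_hasDerivAt (Z := fun t => Y t - Y' t) (r := -1) fun t => by
    refine ((h t).sub (h' t)).congr_deriv ?_
    push_cast
    ring
  simp only [one_mul, neg_mul] at hz hw
  have key : ∀ t, (Real.exp t : ℂ) * (Y 0 + Y' 0) + Real.exp (-t) * (Y 0 - Y' 0) = 2 * Y t := by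
    intro t
    rw [← hz t, ← hw t]
    ring
  have hle : ∀ {a b c : ℂ} {t : ℝ}, 0 ≤ t → ‖c‖ ≤ M →
      (Real.exp t : ℂ) * a + Real.exp (-t) * b = 2 * c → Real.exp t * ‖a‖ ≤ 2 * M + ‖b‖ := by
    intro a b c t ht hc he
    have h1 : (Real.exp t : ℂ) * a = 2 * c - Real.exp (-t) * b := by rw [← he]; ring
    have h2 := congrArg norm h1
    rw [norm_mul, Complex.norm_real, Real.norm_eq_abs, Real.abs_exp] at h2
    rw [h2]
    refine (norm_sub_le _ _).trans ?_
    rw [norm_mul, norm_mul, Complex.norm_real, Real.norm_eq_abs, Real.abs_exp, Complex.norm_two]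
    have h3 : Real.exp (-t) ≤ 1 := Real.exp_le_one_iff.mpr (by linarith)
    nlinarith [norm_nonneg b]
  have h1 : Y 0 + Y' 0 = 0 :=
    eq_zero_of_exp_mul_norm_le fun t ht => hle ht (hM t) (key t)
  have h2 : Y 0 - Y' 0 = 0 :=
    eq_zero_of_exp_mul_norm_le fun t ht => hle ht (hM (-t)) (by
      rw [← key (-t), neg_neg, add_comm])
  linear_combination (h1 + h2) / 2

theorem IsTestFun.comp_sub_left {φ : ℝ → ℂ} (h : IsTestFun φ) (t : ℝ) :
    IsTestFun (fun s => φ (t - s)) :=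
  ⟨h.1.comp (contDiff_const.sub contDiff_id),
    h.2.comp_homeomorph (Homeomorph.subLeft t)⟩

theorem IsTestFun.deriv_comp_sub_left {φ : ℝ → ℂ} (h : IsTestFun φ) (t : ℝ) :
    _root_.deriv (fun s => φ (t - s)) = fun s => -_root_.deriv φ (t - s) := by
  ext s
  have h1 : HasDerivAt (fun s : ℝ => t - s) (-1) s := by
    simpa using (hasDerivAt_id s).const_sub t
  have h2 := (h.hasDerivAt (t - s)).scomp s h1
  rw [neg_one_smul] at h2
  exact h2.deriv

theorem eq_zero_of_forall_integral_mul_testFun (y : L2R)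
    (h : ∀ φ : ℝ → ℂ, IsTestFun φ → ∫ t, y t * φ t = 0) : y = 0 := by
  have hloc : LocallyIntegrable (y : ℝ → ℂ) (volume : Measure ℝ) :=
    (Lp.memLp y).locallyIntegrable (by norm_num)
  refine (Lp.eq_zero_iff_ae_eq_zero).mpr ?_
  refine ae_eq_zero_of_integral_contDiff_smul_eq_zero hloc fun g hg hgs => ?_
  have hφ : IsTestFun (fun t => (g t : ℂ)) :=
    ⟨Complex.ofRealCLM.contDiff.comp hg, hgs.comp_left (g := Complex.ofReal) Complex.ofReal_zero⟩
  rw [← h _ hφ]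
  refine integral_congr_ae (Filter.Eventually.of_forall fun t => ?_)
  simp [mul_comm]

/-- The equation `y'' = y` has no nonzero solution in `L²(ℝ)`. -/
theorem eq_zero_of_hasWeakSecondDeriv_self {y : L2R} (hy : HasWeakSecondDeriv y y) : y = 0 := by
  refine eq_zero_of_forall_integral_mul_testFun y fun ψ hψ => ?_
  have hloc : LocallyIntegrable (y : ℝ → ℂ) (volume : Measure ℝ) :=
    (Lp.memLp y).locallyIntegrable (by norm_num)
  -- Mollification: `y * ρ` is a classical solution of `Y'' = Y`, and the reflection makes its value
  -- at `0` equal to `∫ y ψ`.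
  set ρ : ℝ → ℂ := fun s => ψ (0 - s) with hρ
  have hρt : IsTestFun ρ := hψ.comp_sub_left 0
  have hconv : ∀ {χ : ℝ → ℂ}, IsTestFun χ → ∀ t, HasDerivAt (fun t => ∫ s, y s * χ (t - s))
      (∫ s, y s * deriv χ (t - s)) t := fun hχ t =>
    hχ.2.hasDerivAt_convolution_right (ContinuousLinearMap.mul ℝ ℂ) hloc
      (hχ.1.of_le (by exact_mod_cast le_top)) t
  have hweak : ∀ t, ∫ s, y s * deriv (deriv ρ) (t - s) = ∫ s, y s * ρ (t - s) := by
    intro t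
    rw [← hy _ (hρt.comp_sub_left t), hρt.deriv_comp_sub_left t]
    congr 1
    ext s
    have := congrFun (hρt.deriv.deriv_comp_sub_left t) s
    rw [deriv.fun_neg, this, neg_neg]
  have hY := eq_zero_of_hasDerivAt_of_bounded (hconv hρt)
    (fun t => by rw [← hweak t]; exact hconv hρt.deriv t)
    -- By translation invariance, the pointwise bound `|y ρ| ≤ |y|² + |ρ|²` yields a bound
    -- independent of `t`.
    (M := ∫ s, (‖y s‖ ^ 2 + ‖ρ s‖ ^ 2)) fun t => by
      have hi1 : Integrable (fun s => ‖y s‖ ^ 2) (volume : Measure ℝ) :=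
        (Lp.memLp y).norm.integrable_sq
      have hi2 : Integrable (fun s => ‖ρ s‖ ^ 2) (volume : Measure ℝ) :=
        (hρt.memLp 2).norm.integrable_sq
      have hi3 : Integrable (fun s => ‖ρ (t - s)‖ ^ 2) (volume : Measure ℝ) :=
        ((hρt.comp_sub_left t).memLp 2).norm.integrable_sq
      have h1 : ∫ s, ‖ρ (t - s)‖ ^ 2 = ∫ s, ‖ρ s‖ ^ 2 :=
        integral_sub_left_eq_self (fun s => ‖ρ s‖ ^ 2) volume t
      rw [integral_add hi1 hi2, ← h1, ← integral_add hi1 hi3]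
      refine norm_integral_le_of_norm_le (hi1.add hi3) (Filter.Eventually.of_forall fun s => ?_)
      simp only [norm_mul]
      nlinarith [sq_nonneg (‖y s‖ - ‖ρ (t - s)‖), sq_nonneg ‖y s‖, sq_nonneg ‖ρ (t - s)‖]
  simpa [hρ] using hY

theorem HasWeakSecondDeriv.sub {x x' y y' : L2R} (h : HasWeakSecondDeriv x y)
    (h' : HasWeakSecondDeriv x' y') : HasWeakSecondDeriv (x - x') (y - y') := by
  intro φ hφ
  have h1 := h φ hφ
  have h2 := h' φ hφ
  rw [hφ.deriv.deriv.integral_mul_eq_inner, hφ.integral_mul_eq_inner] at h1 h2 ⊢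
  rw [inner_sub_right, inner_sub_right, h1, h2]

/-- A vector orthogonal to the range solves the adjoint equation weakly. The star appears because
the inner product is conjugate-linear on the left while the distributional pairing is bilinear. -/
theorem hasWeakSecondDeriv_of_inner_eq_zero {y : L2R} {B : L2R →L[ℂ] L2R}
    (hB : ∀ {φ : ℝ → ℂ} (h : IsTestFun φ), ⟪y, B h.toL2⟫_ℂ = ∫ t, (B (star y)) t * φ t)
    (hy : ∀ p ∈ testSecondDerivGraph, ⟪y, p.2 + B p.1⟫_ℂ = 0) :
    HasWeakSecondDeriv (star y) (-(B (star y))) := by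
  intro φ h
  have h1 := hy _ h.mem_testSecondDerivGraph
  rw [inner_add_right, hB h, inner_eq_integral_star_mul _ _ h.deriv.deriv.coeFn_toL2,
    h.integral_mul_eq_inner] at h1
  rw [h.integral_mul_eq_inner, inner_neg_right]
  exact eq_neg_of_add_eq_zero_left h1

theorem eq_zero_of_star_eq_zero {y : L2R} (hy : star y = 0) : y = 0 := by
  rw [← star_star y, hy]
  exact (Lp.eq_zero_iff_ae_eq_zero).mpr
    ((Lp.coeFn_star _).trans ((Lp.coeFn_zero ℂ 2 volume).fun_comp star |>.trans
      (Filter.Eventually.of_forall fun t => star_zero ℂ)))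

/-- The test functions are a core of the Laplacian. -/
theorem HasWeakSecondDeriv.mem_closure_testSecondDerivGraph {x g : L2R}
    (h : HasWeakSecondDeriv x g) : (x, g) ∈ testSecondDerivGraph.topologicalClosure := by
  -- Solve `w'' - w = g - x` within the closure; then `x - w` is an `L²` solution of `z'' = z`, so
  -- `x = w`.
  obtain ⟨w, hw⟩ := exists_mem_closure_testSecondDerivGraph (-ContinuousLinearMap.id ℂ L2R)
    (K := 1) (fun p hp => by
      obtain ⟨φ, hφ, rfl⟩ := exists_of_mem_testSecondDerivGraph hp
      rw [one_mul]
      simpa [sub_eq_add_neg] using hφ.norm_le_norm_deriv_deriv_sub)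
    (fun y hy => by
      have h1 := hasWeakSecondDeriv_of_inner_eq_zero (fun {φ} hφ => by
        rw [neg_apply, neg_apply,
          hφ.integral_mul_eq_inner, inner_neg_right, inner_neg_right]
        rw [ContinuousLinearMap.id_apply, ContinuousLinearMap.id_apply,
          inner_eq_integral_star_mul _ _ hφ.coeFn_toL2, hφ.integral_mul_eq_inner]) hy
      rw [neg_apply, neg_neg] at h1
      exact eq_zero_of_star_eq_zero (eq_zero_of_hasWeakSecondDeriv_self h1)) (g - x)
  rw [neg_apply, ContinuousLinearMap.id_apply, sub_neg_eq_add] at hw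
  have h1 : HasWeakSecondDeriv w (g - x + w) := (closure_testSecondDerivGraph_le hw).2
  have h2 := h.sub h1
  rw [show g - (g - x + w) = x - w by abel] at h2
  have h3 := sub_eq_zero.mp (eq_zero_of_hasWeakSecondDeriv_self h2)
  rwa [← h3, sub_add_cancel] at hw

/-! ### The Jost solution -/

/-- The coefficients of the solution `∑ aₖ e^{-(μ + k) t}` of `u'' = (μ² - C e^{-t}) u`. -/
def jostCoeff {𝕜 : Type*} [Field 𝕜] (C μ : 𝕜) (k : ℕ) : 𝕜 :=
  (-C) ^ k / (k.factorial * ∏ j ∈ Finset.range k, (2 * μ + j + 1))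

theorem jostCoeff_zero {𝕜 : Type*} [Field 𝕜] (C μ : 𝕜) : jostCoeff C μ 0 = 1 := by
  simp [jostCoeff]

/-- Real coefficients serve the differential equation, complex ones the analytic dependence on `μ`.
-/
theorem ofReal_jostCoeff (C μ : ℝ) (k : ℕ) :
    ((jostCoeff C μ k : ℝ) : ℂ) = jostCoeff (C : ℂ) (μ : ℂ) k := by
  simp only [jostCoeff]
  push_cast
  rfl

/-- Compares coefficients of `e^{-(μ+k+1)t}` in the equation, with `(μ+k+1)² - μ² = (k+1)(2μ+k+1)`.
-/
theorem jostCoeff_succ (C : ℝ) {μ : ℝ} (hμ : 0 < μ) (k : ℕ) :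
    (k + 1) * (2 * μ + k + 1) * jostCoeff C μ (k + 1) = -C * jostCoeff C μ k := by
  have h1 : ∏ j ∈ Finset.range k, (2 * μ + j + 1) ≠ 0 :=
    Finset.prod_ne_zero_iff.mpr fun j _ => by positivity
  have h2 : (2 * μ + k + 1) ≠ 0 := by positivity
  have h3 : (k.factorial : ℝ) ≠ 0 := by positivity
  have h4 : (k + 1 : ℝ) ≠ 0 := by positivity
  simp only [jostCoeff, Finset.prod_range_succ, Nat.factorial_succ, pow_succ]
  push_cast
  field_simp

theorem norm_jostCoeff_le (C : ℂ) {μ : ℂ} {c : ℝ} (hc : 0 < c)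
    (hμ : ∀ j : ℕ, c ≤ ‖2 * μ + j + 1‖) (k : ℕ) :
    ‖jostCoeff C μ k‖ ≤ (‖C‖ / c) ^ k / k.factorial := by
  have h1 : c ^ k ≤ ‖∏ j ∈ Finset.range k, (2 * μ + j + 1)‖ := by
    rw [norm_prod]
    calc c ^ k = ∏ j ∈ Finset.range k, c := by simp
      _ ≤ _ := Finset.prod_le_prod (fun _ _ => hc.le) fun j _ => hμ j
  rw [jostCoeff, norm_div, norm_mul, norm_pow, norm_neg, div_pow, div_div,
    Complex.norm_natCast, mul_comm]
  have : (0 : ℝ) < k.factorial := by positivity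
  gcongr

theorem abs_jostCoeff_le (C : ℝ) {μ : ℝ} (hμ : 0 < μ) (k : ℕ) :
    |jostCoeff C μ k| ≤ |C| ^ k / k.factorial := by
  have h := norm_jostCoeff_le (C : ℂ) (μ := (μ : ℂ)) one_pos (fun j => by
    have : (2 * μ + j + 1 : ℂ) = ((2 * μ + j + 1 : ℝ) : ℂ) := by push_cast; rfl
    rw [this, Complex.norm_real, Real.norm_eq_abs, abs_of_nonneg (by positivity)]
    have : (0 : ℝ) ≤ j := j.cast_nonneg
    linarith) k
  rwa [← ofReal_jostCoeff, Complex.norm_real, Complex.norm_real, div_one] at h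

/-- The factor `e^{μ+k}` dominates `e^{-(μ+k)t}` for all `t > -1`, so the series can be
differentiated on an open set containing `0`. -/
theorem pow_mul_exp_mul_jostCoeff_le (C : ℝ) {μ : ℝ} (hμ : 0 < μ) (n k : ℕ) :
    (μ + k) ^ n * |jostCoeff C μ k| * Real.exp (μ + k) ≤
      Real.exp ((n + 1) * μ) * ((|C| * Real.exp (n + 1)) ^ k / k.factorial) := by
  have h1 : (μ + k) ^ n ≤ Real.exp (n * (μ + k)) := by
    rw [Real.exp_nat_mul]
    have := Real.add_one_le_exp (μ + k)
    gcongr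
    linarith
  calc (μ + k) ^ n * |jostCoeff C μ k| * Real.exp (μ + k)
      ≤ Real.exp (n * (μ + k)) * (|C| ^ k / k.factorial) * Real.exp (μ + k) := by
        gcongr
        exact abs_jostCoeff_le C hμ k
    _ = Real.exp (n * (μ + k) + (μ + k)) * (|C| ^ k / k.factorial) := by
        rw [Real.exp_add (n * (μ + k))]; ring
    _ = Real.exp ((n + 1) * μ + k * (n + 1)) * (|C| ^ k / k.factorial) := by
        congr 2; ring
    _ = _ := by
        rw [Real.exp_add, Real.exp_nat_mul, mul_pow]; ring

theorem summable_pow_mul_exp_mul_jostCoeff (C : ℝ) {μ : ℝ} (hμ : 0 < μ) (n : ℕ) :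
    Summable fun k : ℕ => (μ + k) ^ n * |jostCoeff C μ k| * Real.exp (μ + k) :=
  ((Real.summable_pow_div_factorial _).mul_left _).of_nonneg_of_le (fun k => by positivity)
    (pow_mul_exp_mul_jostCoeff_le C hμ n)

theorem summable_pow_mul_jostCoeff (C : ℝ) {μ : ℝ} (hμ : 0 < μ) (n : ℕ) :
    Summable fun k : ℕ => (μ + k) ^ n * |jostCoeff C μ k| :=
  (summable_pow_mul_exp_mul_jostCoeff C hμ n).of_nonneg_of_le (fun k => by positivity) fun k =>
    le_mul_of_one_le_right (by positivity) (Real.one_le_exp (by positivity))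

/-- The `n`-th derivative of the solution `∑ aₖ e^{-(μ + k) t}` of `u'' = (μ² - C e^{-t}) u`. -/
def jostDeriv (C μ : ℝ) (n : ℕ) (t : ℝ) : ℝ :=
  ∑' k : ℕ, (-(μ + k)) ^ n * jostCoeff C μ k * Real.exp (-(μ + k) * t)

theorem abs_jostDeriv_term_le (C : ℝ) {μ : ℝ} (hμ : 0 < μ) (n k : ℕ) {t : ℝ} (ht : -1 < t) :
    ‖(-(μ + k)) ^ n * jostCoeff C μ k * Real.exp (-(μ + k) * t)‖ ≤
      (μ + k) ^ n * |jostCoeff C μ k| * Real.exp (μ + k) := by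
  have h0 : 0 ≤ μ + k := by positivity
  rw [norm_mul, norm_mul, norm_pow, norm_neg, Real.norm_of_nonneg h0, Real.norm_eq_abs,
    Real.norm_eq_abs, Real.abs_exp]
  gcongr
  nlinarith

theorem summable_jostDeriv (C : ℝ) {μ : ℝ} (hμ : 0 < μ) (n : ℕ) {t : ℝ} (ht : -1 < t) :
    Summable fun k : ℕ => (-(μ + k)) ^ n * jostCoeff C μ k * Real.exp (-(μ + k) * t) :=
  Summable.of_norm_bounded (summable_pow_mul_exp_mul_jostCoeff C hμ n)
    fun k => abs_jostDeriv_term_le C hμ n k ht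

theorem hasDerivAt_jostDeriv (C : ℝ) {μ : ℝ} (hμ : 0 < μ) (n : ℕ) {t : ℝ} (ht : -1 < t) :
    HasDerivAt (jostDeriv C μ n) (jostDeriv C μ (n + 1) t) t := by
  refine hasDerivAt_tsum_of_isPreconnected (summable_pow_mul_exp_mul_jostCoeff C hμ (n + 1))
    isOpen_Ioi isPreconnected_Ioi (fun k s _ => ?_)
    (fun k s (hs : -1 < s) => abs_jostDeriv_term_le C hμ (n + 1) k hs) ht (summable_jostDeriv C hμ n ht) ht
  have h1 : HasDerivAt (fun s => Real.exp (-(μ + k) * s))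
      (Real.exp (-(μ + k) * s) * (-(μ + k) * 1)) s := ((hasDerivAt_id s).const_mul _).exp
  refine (h1.const_mul _).congr_deriv ?_
  ring

theorem jostDeriv_two (C : ℝ) {μ : ℝ} (hμ : 0 < μ) {t : ℝ} (ht : -1 < t) :
    jostDeriv C μ 2 t = (μ ^ 2 - C * Real.exp (-t)) * jostDeriv C μ 0 t := by
  have h0 := summable_jostDeriv C hμ 0 ht
  have h2 := summable_jostDeriv C hμ 2 ht
  have h3 : jostDeriv C μ 2 t - μ ^ 2 * jostDeriv C μ 0 t = -C * Real.exp (-t) * jostDeriv C μ 0 t := by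
    simp only [jostDeriv]
    rw [← tsum_mul_left, ← tsum_mul_left, ← (h2.tsum_sub (h0.mul_left _)),
      (h2.sub (h0.mul_left _)).tsum_eq_zero_add]
    -- The term `k = 0` vanishes because `e^{-μt}` solves `u'' = μ² u`; the shifted terms match by
    -- the recurrence.
    rw [show ∀ a b : ℝ, a = 0 → a + b = b from fun a b h => by rw [h, zero_add]]
    · refine tsum_congr fun k => ?_
      have h4 := jostCoeff_succ C hμ k
      have h5 : Real.exp (-(μ + (k + 1 : ℕ)) * t) = Real.exp (-t) * Real.exp (-(μ + k) * t) := by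
        rw [← Real.exp_add]; congr 1; push_cast; ring
      rw [h5]
      push_cast
      linear_combination (Real.exp (-t) * Real.exp (-(μ + k) * t)) * h4
    · simp
      ring
  linear_combination h3

theorem abs_jostDeriv_le (C : ℝ) {μ : ℝ} (hμ : 0 < μ) (n : ℕ) :
    ∃ K : ℝ, ∀ t : ℝ, 0 ≤ t → |jostDeriv C μ n t| ≤ K * Real.exp (-μ * t) := by
  refine ⟨∑' k : ℕ, (μ + k) ^ n * |jostCoeff C μ k|, fun t ht => ?_⟩
  rw [← tsum_mul_right, ← Real.norm_eq_abs, jostDeriv]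
  refine tsum_of_norm_bounded ((summable_pow_mul_jostCoeff C hμ n).mul_right _).hasSum fun k => ?_
  have h0 : 0 ≤ μ + k := by positivity
  rw [norm_mul, norm_mul, norm_pow, norm_neg, Real.norm_of_nonneg h0, Real.norm_eq_abs,
    Real.norm_eq_abs, Real.abs_exp]
  have : (0 : ℝ) ≤ k := k.cast_nonneg
  gcongr
  nlinarith

/-! ### Analyticity in `μ` and finiteness of the zeros -/

/-- The weighted sums of the coefficients are holomorphic in `μ`. -/
theorem differentiableOn_tsum_mul_jostCoeff (C : ℂ) {w : ℕ → ℂ} (hw : ∀ k, ‖w k‖ ≤ 2 ^ k) :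
    DifferentiableOn ℂ (fun μ => ∑' k, w k * jostCoeff C μ k) {μ : ℂ | -(1 / 4) < μ.re} := by
  -- Each factor `2μ + j + 1` has real part above `1/2` here, so there are no poles and the terms
  -- have a uniform summable bound.
  have hre : ∀ μ ∈ {μ : ℂ | -(1 / 4) < μ.re}, ∀ j : ℕ, (1 / 2 : ℝ) ≤ ‖2 * μ + j + 1‖ := by
    intro μ hμ j
    refine le_trans ?_ (Complex.re_le_norm _)
    have hμ' : -(1 / 4) < μ.re := hμ
    have : (0 : ℝ) ≤ j := j.cast_nonneg
    simp
    linarith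
  refine Complex.differentiableOn_tsum_of_summable_norm
    (Real.summable_pow_div_factorial (2 * (‖C‖ / (1 / 2)))) (fun k => ?_)
    (isOpen_lt continuous_const Complex.continuous_re) fun k μ hμ => ?_
  · unfold jostCoeff
    refine DifferentiableOn.const_mul (DifferentiableOn.div (by fun_prop) (by fun_prop) ?_) _
    intro μ hμ
    refine mul_ne_zero (by exact_mod_cast k.factorial_ne_zero) ?_
    refine Finset.prod_ne_zero_iff.mpr fun j _ h => ?_
    have := hre μ hμ j
    rw [h, norm_zero] at this
    norm_num at this
  · rw [norm_mul, mul_pow, mul_div_assoc]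
    exact mul_le_mul (hw k) (norm_jostCoeff_le C (by norm_num) (hre μ hμ) k) (norm_nonneg _)
      (by positivity)

/-- For large `μ` the factors are at least `2μ ≥ 16‖C‖`, so the `k`-th term is at most `2^k / 16^k`,
and the tail from `k = 1` sums to at most `1/7`. -/
theorem norm_tsum_mul_jostCoeff_sub_le (C : ℂ) {w : ℕ → ℂ} (hw : ∀ k, ‖w k‖ ≤ 2 ^ k) {μ : ℝ}
    (hμ : 0 < μ) (hμC : 8 * ‖C‖ ≤ μ) :
    ‖∑' k, w k * jostCoeff C μ k - w 0‖ ≤ 1 / 4 := by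
  have hμ' : ∀ j : ℕ, 2 * μ ≤ ‖2 * (μ : ℂ) + j + 1‖ := by
    intro j
    refine le_trans ?_ (Complex.re_le_norm _)
    have : (0 : ℝ) ≤ j := j.cast_nonneg
    simp
    linarith
  have hx : ‖C‖ / (2 * μ) ≤ 1 / 16 := by
    rw [div_le_iff₀ (by positivity)]
    linarith
  have hterm : ∀ k, ‖w k * jostCoeff C μ k‖ ≤ (1 / 8) ^ k := by
    intro k
    rw [norm_mul]
    calc ‖w k‖ * ‖jostCoeff C (μ : ℂ) k‖ ≤ 2 ^ k * (1 / 16) ^ k := by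
          refine mul_le_mul (hw k) ?_ (norm_nonneg _) (by positivity)
          refine (norm_jostCoeff_le C (by positivity) hμ' k).trans ?_
          refine (div_le_self (by positivity) (by exact_mod_cast k.factorial_pos)).trans ?_
          gcongr
      _ = (1 / 8) ^ k := by rw [← mul_pow]; norm_num
  have hgeom : HasSum (fun k : ℕ => (1 / 8 : ℝ) ^ k) (1 - 1 / 8)⁻¹ :=
    hasSum_geometric_of_lt_one (by norm_num) (by norm_num)
  have hsum : Summable fun k => w k * jostCoeff C (μ : ℂ) k :=
    Summable.of_norm_bounded hgeom.summable hterm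
  rw [hsum.tsum_eq_zero_add, jostCoeff_zero, mul_one, add_sub_cancel_left]
  refine (tsum_of_norm_bounded (hgeom.mul_left (1 / 8)) fun k => ?_).trans (by norm_num)
  rw [← pow_succ']
  exact hterm (k + 1)

/-- The product `u(0) u'(0)`, up to sign, for the solution `∑ aₖ e^{-(μ + k) t}`. -/
def jostProduct (C μ : ℂ) : ℂ :=
  (∑' k, 1 * jostCoeff C μ k) *
    (μ * (∑' k, 1 * jostCoeff C μ k) + ∑' k : ℕ, (k : ℂ) * jostCoeff C μ k)

theorem norm_natCast_le_two_pow (k : ℕ) : ‖(k : ℂ)‖ ≤ 2 ^ k := by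
  rw [Complex.norm_natCast]
  exact_mod_cast k.lt_two_pow_self.le

theorem norm_one_le_two_pow (k : ℕ) : ‖(1 : ℂ)‖ ≤ 2 ^ k := by
  rw [norm_one]
  exact one_le_pow₀ one_le_two

/-- The sum for `u(0)` is within `1/4` of `1`, and the sum weighted by `k` is at most `1/4`, too
small to cancel `μ u(0)`. -/
theorem jostProduct_ne_zero (C : ℂ) {μ : ℝ} (hμ : 1 ≤ μ) (hμC : 8 * ‖C‖ ≤ μ) :
    jostProduct C μ ≠ 0 := by
  have h1 := norm_tsum_mul_jostCoeff_sub_le C norm_one_le_two_pow (by linarith) hμC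
  have h2 := norm_tsum_mul_jostCoeff_sub_le C norm_natCast_le_two_pow (by linarith) hμC
  rw [Nat.cast_zero, sub_zero] at h2
  unfold jostProduct
  set a := ∑' k, 1 * jostCoeff C (μ : ℂ) k
  set b := ∑' k : ℕ, (k : ℂ) * jostCoeff C (μ : ℂ) k
  have h3 : 3 / 4 ≤ ‖a‖ := by
    have h4 := norm_sub_norm_le (1 : ℂ) (1 - a)
    rw [sub_sub_cancel, norm_one, norm_sub_rev] at h4
    linarith
  refine mul_ne_zero (norm_pos_iff.mp (by linarith)) fun h => ?_
  have h4 : (μ : ℂ) * a = -b := eq_neg_of_add_eq_zero_left h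
  have h5 := congrArg norm h4
  rw [norm_mul, norm_neg, Complex.norm_real, Real.norm_of_nonneg (by linarith)] at h5
  nlinarith

theorem finite_setOf_jostProduct_eq_zero (C : ℂ) :
    {μ : ℝ | 0 < μ ∧ jostProduct C μ = 0}.Finite := by
  set M : ℝ := 8 * ‖C‖ + 1 with hM
  have hCn := norm_nonneg C
  set U : Set ℂ := {μ : ℂ | -(1 / 4) < μ.re}
  have hUo : IsOpen U := isOpen_lt continuous_const Complex.continuous_re
  have hUc : IsPreconnected U := (convex_halfSpace_re_gt _).isPreconnected
  have hG : AnalyticOnNhd ℂ (jostProduct C) U := by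
    refine DifferentiableOn.analyticOnNhd ?_ hUo
    have h1 := differentiableOn_tsum_mul_jostCoeff C norm_one_le_two_pow
    have h2 := differentiableOn_tsum_mul_jostCoeff C norm_natCast_le_two_pow
    exact h1.mul ((differentiableOn_id.mul h1).add h2)
  by_contra hinf
  set Z : Set ℂ := Complex.ofReal '' {μ : ℝ | 0 < μ ∧ jostProduct C μ = 0} with hZ
  have hZinf : Z.Infinite := Set.Infinite.image Complex.ofReal_injective.injOn hinf
  have hZK : Z ⊆ Complex.ofReal '' Set.Icc 0 M := by
    rintro _ ⟨μ, ⟨h0, hμ⟩, rfl⟩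
    refine ⟨μ, ⟨h0.le, ?_⟩, rfl⟩
    by_contra! h
    exact jostProduct_ne_zero C (by linarith) (by linarith) hμ
  obtain ⟨z, hzK, hz⟩ := hZinf.exists_accPt_of_subset_isCompact
    (isCompact_Icc.image Complex.continuous_ofReal) hZK
  have hzU : z ∈ U := by
    obtain ⟨μ, hμ, rfl⟩ := hzK
    change -(1 / 4) < (μ : ℂ).re
    rw [Complex.ofReal_re]
    linarith [hμ.1]
  have hfreq : ∃ᶠ w in nhdsWithin z {z}ᶜ, jostProduct C w = 0 := by
    refine (accPt_iff_frequently_nhdsNE.mp hz).mono ?_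
    rintro _ ⟨μ, hμ, rfl⟩
    exact hμ.2
  have hzero := hG.eqOn_zero_of_preconnected_of_frequently_eq_zero hUc hzU hfreq
  have hMU : (M : ℂ) ∈ U := by
    change -(1 / 4) < (M : ℂ).re
    rw [Complex.ofReal_re]
    linarith
  exact jostProduct_ne_zero C (by linarith) (by linarith) (hzero hMU)

/-- Termwise differentiation gives `u'(0) = -∑ (μ + k) aₖ`, so the second factor of the product is
`-u'(0)`. -/
theorem jostProduct_ofReal (C : ℝ) {μ : ℝ} (hμ : 0 < μ) :
    jostProduct C μ = ((-(jostDeriv C μ 0 0 * jostDeriv C μ 1 0) : ℝ) : ℂ) := by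
  have h0 : ∑' k, 1 * jostCoeff (C : ℂ) (μ : ℂ) k = (jostDeriv C μ 0 0 : ℂ) := by
    simp only [jostDeriv, Complex.ofReal_tsum]
    refine tsum_congr fun k => ?_
    rw [← ofReal_jostCoeff]
    simp
  have hs0 := summable_jostDeriv C hμ 0 (t := 0) (by norm_num)
  have hs1 := summable_jostDeriv C hμ 1 (t := 0) (by norm_num)
  have h1 : ∑' k : ℕ, (k : ℂ) * jostCoeff (C : ℂ) (μ : ℂ) k =
      ((-jostDeriv C μ 1 0 - μ * jostDeriv C μ 0 0 : ℝ) : ℂ) := by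
    rw [jostDeriv, jostDeriv, ← tsum_neg, ← tsum_mul_left, ← hs1.neg.tsum_sub (hs0.mul_left μ),
      Complex.ofReal_tsum]
    refine tsum_congr fun k => ?_
    rw [← ofReal_jostCoeff]
    push_cast
    simp
    ring
  rw [jostProduct, h0, h1]
  push_cast
  ring

/-! ### A priori estimates on half-lines and on the line -/

/-- Growth bound for the initial value problem `a'' + (C e^{-t} - l) a = f` on a half-line. -/
theorem sq_add_sq_le_of_hasDerivAt {C l : ℝ} (hC : 0 ≤ C) (hl : 0 < l) {a b c f : ℝ → ℝ} {L : ℝ}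
    (ha : ∀ t, HasDerivAt a (b t) t) (hb : ∀ t, HasDerivAt b (c t) t) (hf : Continuous f)
    (hfc : ∀ t, f t = c t + (C * Real.exp (-t) - l) * a t) {t : ℝ} (ht : t ∈ Set.Icc 0 L) :
    a t ^ 2 + b t ^ 2 ≤
      Real.exp ((l + C + 2) * t) * (a 0 ^ 2 + b 0 ^ 2 + ∫ s in 0..L, f s ^ 2) := by
  -- Gronwall constant: `l + C` absorbs the zeroth-order term, and `2` absorbs `2ab` and `2bf`, up
  -- to `f²`.
  set M := l + C + 2 with hM
  set g : ℝ → ℝ := fun s => Real.exp (-M * s) * (a s ^ 2 + b s ^ 2) with hg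
  set g' : ℝ → ℝ := fun s => Real.exp (-M * s) *
    (2 * a s * b s + 2 * b s * c s - M * (a s ^ 2 + b s ^ 2)) with hg'
  have hac : Continuous a := continuous_iff_continuousAt.mpr fun s => (ha s).continuousAt
  have hbc : Continuous b := continuous_iff_continuousAt.mpr fun s => (hb s).continuousAt
  have hcc : Continuous c := by
    have : c = fun t => f t - (C * Real.exp (-t) - l) * a t := by
      ext t; rw [hfc]; ring
    rw [this]; fun_prop
  have hgd : ∀ s, HasDerivAt g (g' s) s := by
    intro s
    have h1 : HasDerivAt (fun s => Real.exp (-M * s)) (Real.exp (-M * s) * (-M * 1)) s :=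
      ((hasDerivAt_id s).const_mul _).exp
    refine (h1.mul (((ha s).pow 2).add ((hb s).pow 2))).congr_deriv ?_
    simp only [hg', Pi.add_apply, Pi.pow_apply]
    ring
  have hle : ∀ s ∈ Set.Icc 0 t, g' s ≤ f s ^ 2 := by
    intro s hs
    have he : Real.exp (-M * s) ≤ 1 := Real.exp_le_one_iff.mpr (by
      have : 0 ≤ M * s := mul_nonneg (by positivity) hs.1
      linarith)
    have hV : Real.exp (-s) ≤ 1 := Real.exp_le_one_iff.mpr (by linarith [hs.1])
    have hV0 := Real.exp_pos (-s)
    have h1 : 2 * a s * b s + 2 * b s * c s - M * (a s ^ 2 + b s ^ 2) ≤ f s ^ 2 := by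
      have h2 : c s = f s - (C * Real.exp (-s) - l) * a s := by rw [hfc]; ring
      have h3 : -(2 * b s * ((C * Real.exp (-s) - l) * a s)) ≤ (l + C) * (a s ^ 2 + b s ^ 2) := by
        -- The right side of the goal minus the left is exactly the sum of these three nonnegative
        -- terms.
        have h4 : 0 ≤ C * Real.exp (-s) * (a s + b s) ^ 2 := by positivity
        have h5 : 0 ≤ l * (a s - b s) ^ 2 := by positivity
        have h6 : 0 ≤ C * (1 - Real.exp (-s)) * (a s ^ 2 + b s ^ 2) :=
          mul_nonneg (mul_nonneg hC (by linarith)) (by positivity)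
        nlinarith
      rw [h2, hM]
      nlinarith [sq_nonneg (a s - b s), sq_nonneg (b s - f s), sq_nonneg (a s), sq_nonneg (b s)]
    have h7 : g' s ≤ Real.exp (-M * s) * f s ^ 2 :=
      mul_le_mul_of_nonneg_left h1 (Real.exp_pos _).le
    nlinarith [sq_nonneg (f s)]
  have h1 : g t - g 0 = ∫ s in 0..t, g' s :=
    (intervalIntegral.integral_eq_sub_of_hasDerivAt (fun s _ => hgd s)
      (Continuous.intervalIntegrable (by fun_prop) _ _)).symm
  have h2 : ∫ s in 0..t, g' s ≤ ∫ s in 0..t, f s ^ 2 :=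
    intervalIntegral.integral_mono_on ht.1 (Continuous.intervalIntegrable (by fun_prop) _ _)
      (Continuous.intervalIntegrable (by fun_prop) _ _) hle
  have h3 : ∫ s in 0..t, f s ^ 2 ≤ ∫ s in 0..L, f s ^ 2 :=
    intervalIntegral.integral_mono_interval le_rfl ht.1 ht.2
      (Filter.Eventually.of_forall fun s => sq_nonneg _)
      (Continuous.intervalIntegrable (by fun_prop) _ _)
  have h4 : g 0 = a 0 ^ 2 + b 0 ^ 2 := by simp [hg]
  have h5 : a t ^ 2 + b t ^ 2 = Real.exp (M * t) * g t := by
    simp only [hg]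
    rw [← mul_assoc, ← Real.exp_add]
    simp
  rw [h5]
  exact mul_le_mul_of_nonneg_left (by linarith) (Real.exp_pos _).le

/-- Compactly supported solutions of `a'' + (C e^{-t} - l) a = f` on a half-line are controlled by
`f` and the initial data. -/
theorem exists_integral_sq_le_of_hasDerivAt {C l : ℝ} (hC : 0 ≤ C) (hl : 0 < l) :
    ∃ K : ℝ, 0 ≤ K ∧ ∀ (a b c f : ℝ → ℝ) (L : ℝ), 0 ≤ L → (∀ t, HasDerivAt a (b t) t) →
      (∀ t, HasDerivAt b (c t) t) → Continuous f →
      (∀ t, f t = c t + (C * Real.exp (-t) - l) * a t) → a L = 0 →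
      ∫ t in 0..L, a t ^ 2 ≤ K * (a 0 ^ 2 + b 0 ^ 2 + ∫ t in 0..L, f t ^ 2) := by
  -- Beyond `N` the potential is at most `l / 2`, so `-l` dominates. The witness uses `e^x ≥ x + 1`.
  obtain ⟨N, hN0, hN⟩ : ∃ N : ℝ, 0 ≤ N ∧ C * Real.exp (-N) ≤ l / 2 := by
    refine ⟨2 * C / l, by positivity, ?_⟩
    rw [Real.exp_neg, ← div_eq_mul_inv, div_le_iff₀ (Real.exp_pos _)]
    have h1 := Real.add_one_le_exp (2 * C / l)
    calc C ≤ l / 2 * (2 * C / l + 1) := by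
          have : l / 2 * (2 * C / l + 1) = C + l / 2 := by field_simp
          rw [this]; linarith
      _ ≤ _ := by gcongr
  set M := l + C + 2 with hM
  set D := C * Real.exp (M * N + N) with hD
  refine ⟨4 / l * (1 / 2 + 1 / l + D), by positivity, ?_⟩
  intro a b c f L hL ha hb hf hfc haL
  set J := ∫ t in 0..L, f t ^ 2 with hJ
  set Q := a 0 ^ 2 + b 0 ^ 2 + J with hQ
  have hJ0 : 0 ≤ J := intervalIntegral.integral_nonneg hL fun t _ => sq_nonneg _
  have hQ0 : 0 ≤ Q := by positivity
  have hac : Continuous a := continuous_iff_continuousAt.mpr fun s => (ha s).continuousAt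
  have hbc : Continuous b := continuous_iff_continuousAt.mpr fun s => (hb s).continuousAt
  have hcc : Continuous c := by
    have : c = fun t => f t - (C * Real.exp (-t) - l) * a t := by
      ext t; rw [hfc]; ring
    rw [this]; fun_prop
  -- Before `N` the growth bound applies; keeping the factor `e^{-t}`, whose integral is at most
  -- `1`, makes the constant independent of `L`.
  have hV : ∀ t ∈ Set.Icc 0 L, C * Real.exp (-t) * a t ^ 2 ≤
      l / 2 * a t ^ 2 + D * Q * Real.exp (-t) := by
    intro t ht
    rcases le_total N t with h | h
    · have h1 : C * Real.exp (-t) ≤ l / 2 := le_trans (by gcongr) hN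
      have h2 : C * Real.exp (-t) * a t ^ 2 ≤ l / 2 * a t ^ 2 := by gcongr
      have h3 : 0 ≤ D * Q * Real.exp (-t) := by positivity
      linarith
    · have h1 := sq_add_sq_le_of_hasDerivAt hC hl ha hb hf hfc ht
      have h2 : a t ^ 2 ≤ Real.exp (M * N + N) * Q := by
        refine (le_add_of_nonneg_right (sq_nonneg (b t))).trans (h1.trans ?_)
        refine mul_le_mul_of_nonneg_right (Real.exp_le_exp.mpr ?_) hQ0
        have : M * t ≤ M * N := by gcongr
        linarith
      calc C * Real.exp (-t) * a t ^ 2 ≤ C * Real.exp (-t) * (Real.exp (M * N + N) * Q) := by gcongr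
        _ = D * Q * Real.exp (-t) := by rw [hD]; ring
        _ ≤ _ := le_add_of_nonneg_left (by positivity)
  -- Energy estimate: `b² + a c` is `(a b)'`, which integrates to `-a(0) b(0)`. The term `a f` is
  -- absorbed by completing a square.
  have hpt : ∀ t ∈ Set.Icc 0 L,
      l / 4 * a t ^ 2 ≤ (b t * b t + a t * c t) + 1 / l * f t ^ 2 + D * Q * Real.exp (-t) := by
    intro t ht
    have h1 := hV t ht
    have h2 : c t = f t - (C * Real.exp (-t) - l) * a t := by rw [hfc]; ring
    have h3 : 0 ≤ 1 / l * (l / 2 * a t + f t) ^ 2 := by positivity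
    have h4 : 1 / l * (l / 2 * a t + f t) ^ 2 = l / 4 * a t ^ 2 + a t * f t + 1 / l * f t ^ 2 := by
      field_simp
      ring
    rw [h2]
    nlinarith [sq_nonneg (b t)]
  have hint : ∀ g : ℝ → ℝ, Continuous g → IntervalIntegrable g volume 0 L :=
    fun g hg => hg.intervalIntegrable _ _
  have h1 := intervalIntegral.integral_mono_on hL (hint _ (by fun_prop)) (hint _ (by fun_prop)) hpt
  rw [intervalIntegral.integral_add (hint _ (by fun_prop)) (hint _ (by fun_prop)),
    intervalIntegral.integral_add (hint _ (by fun_prop)) (hint _ (by fun_prop)),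
    intervalIntegral.integral_const_mul, intervalIntegral.integral_const_mul,
    intervalIntegral.integral_const_mul,
    intervalIntegral.integral_eq_sub_of_hasDerivAt (fun t _ => (ha t).mul (hb t))
      (hint _ (by fun_prop))] at h1
  have h2 : ∫ t in 0..L, Real.exp (-t) ≤ 1 := by
    rw [intervalIntegral.integral_comp_neg (fun t => Real.exp t), integral_exp]
    have := Real.exp_pos (-L)
    simp
    exact this.le
  have h3 : D * Q * ∫ t in 0..L, Real.exp (-t) ≤ D * Q :=
    mul_le_of_le_one_right (by positivity) h2
  simp only [Pi.mul_apply, haL, zero_mul, zero_sub] at h1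
  have h4 : l / 4 * ∫ t in 0..L, a t ^ 2 ≤ (1 / 2 + 1 / l + D) * Q := by
    have h5 : 1 / l * J ≤ 1 / l * Q := by
      gcongr
      rw [hQ]; nlinarith [sq_nonneg (a 0), sq_nonneg (b 0)]
    have h6 : -(a 0 * b 0) ≤ 1 / 2 * Q := by
      rw [hQ]; nlinarith [sq_nonneg (a 0 + b 0)]
    linarith
  calc ∫ t in 0..L, a t ^ 2 = 4 / l * (l / 4 * ∫ t in 0..L, a t ^ 2) := by field_simp
    _ ≤ 4 / l * ((1 / 2 + 1 / l + D) * Q) := by gcongr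
    _ = _ := by ring

/-- The Wronskian at `0` of a compactly supported function with the decaying solution. -/
theorem exists_sq_wronskian_le (C : ℝ) {μ : ℝ} (hμ : 0 < μ) :
    ∃ K : ℝ, 0 ≤ K ∧ ∀ (a b c f : ℝ → ℝ) (L : ℝ), 0 ≤ L → (∀ t, HasDerivAt a (b t) t) →
      (∀ t, HasDerivAt b (c t) t) → Continuous f →
      (∀ t, f t = c t + (C * Real.exp (-t) - μ ^ 2) * a t) → a L = 0 → b L = 0 →
      (jostDeriv C μ 0 0 * b 0 - jostDeriv C μ 1 0 * a 0) ^ 2 ≤ K * ∫ t in 0..L, f t ^ 2 := by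
  obtain ⟨D, hD⟩ := abs_jostDeriv_le C hμ 0
  -- `D² / (2μ)` is the integral of `D² e^{-2μt}` over the half-line; the `1` keeps the constant
  -- positive for division.
  refine ⟨D ^ 2 / (2 * μ) + 1, by positivity, ?_⟩
  intro a b c f L hL ha hb hf hfc haL hbL
  set K := D ^ 2 / (2 * μ) + 1 with hK
  have hK0 : 0 < K := by positivity
  set u := jostDeriv C μ 0 with hu
  have hud : ∀ t ∈ Set.uIcc 0 L, HasDerivAt u (jostDeriv C μ 1 t) t := fun t ht =>
    hasDerivAt_jostDeriv C hμ 0 (by rw [Set.uIcc_of_le hL] at ht; linarith [ht.1])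
  have hu'd : ∀ t ∈ Set.uIcc 0 L, HasDerivAt (jostDeriv C μ 1)
      ((μ ^ 2 - C * Real.exp (-t)) * u t) t := fun t ht => by
    have h0 : -1 < t := by rw [Set.uIcc_of_le hL] at ht; linarith [ht.1]
    rw [hu, ← jostDeriv_two C hμ h0]
    exact hasDerivAt_jostDeriv C hμ 1 h0
  have huc : ContinuousOn u (Set.uIcc 0 L) := fun t ht => (hud t ht).continuousAt.continuousWithinAt
  -- The Wronskian `u b - u' a` has derivative `u f` and vanishes at `L`.
  have hW : ∫ t in 0..L, u t * f t = -(u 0 * b 0 - jostDeriv C μ 1 0 * a 0) := by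
    have h1 : ∀ t ∈ Set.uIcc 0 L, HasDerivAt (fun t => u t * b t - jostDeriv C μ 1 t * a t)
        (u t * f t) t := fun t ht => by
      refine (((hud t ht).mul (hb t)).sub ((hu'd t ht).mul (ha t))).congr_deriv ?_
      rw [hfc]
      ring
    rw [intervalIntegral.integral_eq_sub_of_hasDerivAt h1
      (huc.mul hf.continuousOn).intervalIntegrable, haL, hbL]
    ring
  have hP : ∫ t in 0..L, u t ^ 2 ≤ K := by
    have h1 : ∀ t ∈ Set.Icc 0 L, u t ^ 2 ≤ D ^ 2 * Real.exp (-(2 * μ) * t) := fun t ht => by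
      calc u t ^ 2 = |u t| ^ 2 := (sq_abs _).symm
        _ ≤ (D * Real.exp (-μ * t)) ^ 2 := by
          gcongr
          exact hD t ht.1
        _ = _ := by
          rw [mul_pow, ← Real.exp_nat_mul]
          congr 2
          push_cast
          ring
    have h2 := intervalIntegral.integral_mono_on (μ := volume) hL (huc.pow 2).intervalIntegrable
      (Continuous.intervalIntegrable (by fun_prop) _ _) h1
    rw [intervalIntegral.integral_const_mul, intervalIntegral.integral_comp_mul_left
      (fun t => Real.exp t) (by linarith : -(2 * μ) ≠ 0), integral_exp] at h2
    refine h2.trans ?_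
    have h3 := Real.exp_pos (-(2 * μ) * L)
    have h4 : D ^ 2 * ((-(2 * μ))⁻¹ • (Real.exp (-(2 * μ) * L) - Real.exp (-(2 * μ) * 0))) =
        D ^ 2 / (2 * μ) - D ^ 2 / (2 * μ) * Real.exp (-(2 * μ) * L) := by
      rw [mul_zero, Real.exp_zero, smul_eq_mul, inv_neg]
      ring
    rw [h4, hK]
    have h5 : 0 ≤ D ^ 2 / (2 * μ) * Real.exp (-(2 * μ) * L) := by positivity
    linarith
  set w := u 0 * b 0 - jostDeriv C μ 1 0 * a 0 with hw
  -- Cauchy–Schwarz for `∫ u f`, by a nonnegative quadratic with the multiplier `w / K` adapted to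
  -- `∫ u² ≤ K`.
  have hsq : 0 ≤ ∫ t in 0..L, (f t + w / K * u t) ^ 2 :=
    intervalIntegral.integral_nonneg hL fun t _ => sq_nonneg _
  have hi1 : IntervalIntegrable (fun t => f t ^ 2) volume 0 L :=
    (hf.pow 2).intervalIntegrable _ _
  have hi2 : IntervalIntegrable (fun t => u t * f t) volume 0 L :=
    (huc.mul hf.continuousOn).intervalIntegrable
  have hi3 : IntervalIntegrable (fun t => u t ^ 2) volume 0 L := (huc.pow 2).intervalIntegrable
  have hexp : ∫ t in 0..L, (f t + w / K * u t) ^ 2 =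
      (∫ t in 0..L, f t ^ 2) + 2 * (w / K) * (∫ t in 0..L, u t * f t) +
        (w / K) ^ 2 * ∫ t in 0..L, u t ^ 2 := by
    rw [← intervalIntegral.integral_const_mul, ← intervalIntegral.integral_const_mul,
      ← intervalIntegral.integral_add hi1 (hi2.const_mul _),
      ← intervalIntegral.integral_add (hi1.add (hi2.const_mul _)) (hi3.const_mul _)]
    refine intervalIntegral.integral_congr fun t _ => ?_
    ring
  rw [hexp, hW] at hsq
  have h6 : (w / K) ^ 2 * ∫ t in 0..L, u t ^ 2 ≤ (w / K) ^ 2 * K := by gcongr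
  have h7 : (w / K) ^ 2 * K = w ^ 2 / K := by field_simp
  have h8 : 2 * (w / K) * -w = -(2 * (w ^ 2 / K)) := by ring
  rw [h8] at hsq
  rw [mul_comm, ← div_le_iff₀ hK0]
  linarith

/-- Reflection turns the left half-line into a second right half-line problem with the sign of `b 0`
reversed. The two Wronskians `p b ∓ q a` determine `a 0` and `b 0` when `p` and `q` are nonzero. -/
theorem exists_integral_sq_le_of_jostDeriv_ne_zero {C μ : ℝ} (hC : 0 ≤ C) (hμ : 0 < μ)
    (h0 : jostDeriv C μ 0 0 ≠ 0) (h1 : jostDeriv C μ 1 0 ≠ 0) :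
    ∃ K : ℝ, 0 ≤ K ∧ ∀ (a b c : ℝ → ℝ) (L : ℝ), 0 ≤ L → (∀ t, HasDerivAt a (b t) t) →
      (∀ t, HasDerivAt b (c t) t) → Continuous c → (∀ t, L ≤ |t| → a t = 0) →
      (∀ t, L ≤ |t| → b t = 0) →
      ∫ t in -L..L, a t ^ 2 ≤
        K * ∫ t in -L..L, (c t + (C * Real.exp (-|t|) - μ ^ 2) * a t) ^ 2 := by
  obtain ⟨K₁, hK₁, hgrow⟩ := exists_integral_sq_le_of_hasDerivAt hC (sq_pos_of_pos hμ)
  obtain ⟨K₂, hK₂, hwron⟩ := exists_sq_wronskian_le C hμ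
  set p := jostDeriv C μ 0 0
  set q := jostDeriv C μ 1 0
  set K₃ := K₂ / (2 * p ^ 2) + K₂ / (2 * q ^ 2) with hK₃
  have hK₃0 : 0 ≤ K₃ := by positivity
  refine ⟨K₁ * (2 * K₃ + 1), by positivity, ?_⟩
  intro a b c L hL ha hb hc haL hbL
  have hac : Continuous a := continuous_iff_continuousAt.mpr fun s => (ha s).continuousAt
  set f : ℝ → ℝ := fun t => c t + (C * Real.exp (-|t|) - μ ^ 2) * a t with hf
  set fr : ℝ → ℝ := fun t => c t + (C * Real.exp (-t) - μ ^ 2) * a t with hfr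
  set fl : ℝ → ℝ := fun t => c (-t) + (C * Real.exp (-t) - μ ^ 2) * a (-t) with hfl
  have hfc : Continuous f := by fun_prop
  have hfrc : Continuous fr := by fun_prop
  have hflc : Continuous fl := by fun_prop
  have hLa : L ≤ |L| := le_abs_self L
  have hLa' : L ≤ |-L| := by rw [abs_neg]; exact hLa
  have hfrf : ∫ t in 0..L, fr t ^ 2 = ∫ t in 0..L, f t ^ 2 := by
    refine intervalIntegral.integral_congr fun t ht => ?_
    rw [Set.uIcc_of_le hL] at ht
    simp only [hf, hfr, abs_of_nonneg ht.1]
  have hneg : ∀ g : ℝ → ℝ, ∫ t in 0..L, g (-t) = ∫ t in -L..0, g t := by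
    intro g
    rw [intervalIntegral.integral_comp_neg, neg_zero]
  have hflf : ∫ t in 0..L, fl t ^ 2 = ∫ t in -L..0, f t ^ 2 := by
    rw [← hneg fun t => f t ^ 2]
    refine intervalIntegral.integral_congr fun t ht => ?_
    rw [Set.uIcc_of_le hL] at ht
    simp only [hf, hfl, abs_neg, abs_of_nonneg ht.1]
  have ha' : ∀ t, HasDerivAt (fun t => a (-t)) (-b (-t)) t := fun t => by
    refine ((ha (-t)).scomp t (hasDerivAt_neg t)).congr_deriv ?_
    simp
  have hb' : ∀ t, HasDerivAt (fun t => -b (-t)) (c (-t)) t := fun t => by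
    refine ((hb (-t)).scomp t (hasDerivAt_neg t)).neg.congr_deriv ?_
    simp
  have hgr := hgrow a b c fr L hL ha hb hfrc (fun t => rfl) (haL L hLa)
  have hgl := hgrow _ _ _ fl L hL ha' hb' hflc (fun t => rfl) (haL (-L) hLa')
  have hwr := hwron a b c fr L hL ha hb hfrc (fun t => rfl) (haL L hLa) (hbL L hLa)
  have hwl := hwron _ _ _ fl L hL ha' hb' hflc (fun t => rfl) (haL (-L) hLa')
    (by rw [hbL (-L) hLa', neg_zero])
  rw [hneg (fun t => a t ^ 2)] at hgl
  simp only [neg_zero] at hgl hwl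
  rw [hfrf] at hgr hwr
  rw [hflf] at hgl hwl
  have hi : ∀ g : ℝ → ℝ, Continuous g → ∀ x y, IntervalIntegrable g volume x y :=
    fun g hg x y => hg.intervalIntegrable x y
  have hsplit : ∀ g : ℝ → ℝ, Continuous g →
      ∫ t in -L..L, g t = (∫ t in -L..0, g t) + ∫ t in 0..L, g t := fun g hg =>
    (intervalIntegral.integral_add_adjacent_intervals (hi g hg _ _) (hi g hg _ _)).symm
  rw [hsplit (fun t => a t ^ 2) (by fun_prop), hsplit (fun t => f t ^ 2) (by fun_prop)]
  set Jr := ∫ t in 0..L, f t ^ 2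
  set Jl := ∫ t in -L..0, f t ^ 2
  -- Parallelogram identity: the squares of the two Wronskians add up to `2 (p² b² + q² a²)`.
  have hpb : p ^ 2 * b 0 ^ 2 ≤ K₂ / 2 * (Jl + Jr) := by nlinarith [sq_nonneg (q * a 0)]
  have hqa : q ^ 2 * a 0 ^ 2 ≤ K₂ / 2 * (Jl + Jr) := by nlinarith [sq_nonneg (p * b 0)]
  have hb0 : b 0 ^ 2 ≤ K₂ / (2 * p ^ 2) * (Jl + Jr) := by
    have : K₂ / (2 * p ^ 2) * (Jl + Jr) = K₂ / 2 * (Jl + Jr) / p ^ 2 := by field_simp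
    rw [this, le_div_iff₀ (by positivity)]
    linarith
  have ha0 : a 0 ^ 2 ≤ K₂ / (2 * q ^ 2) * (Jl + Jr) := by
    have : K₂ / (2 * q ^ 2) * (Jl + Jr) = K₂ / 2 * (Jl + Jr) / q ^ 2 := by field_simp
    rw [this, le_div_iff₀ (by positivity)]
    linarith
  have hsum : a 0 ^ 2 + b 0 ^ 2 ≤ K₃ * (Jl + Jr) := by rw [hK₃, add_mul]; linarith
  calc (∫ t in -L..0, a t ^ 2) + ∫ t in 0..L, a t ^ 2
      ≤ K₁ * (2 * (a 0 ^ 2 + b 0 ^ 2) + (Jl + Jr)) := by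
        rw [neg_sq] at hgl
        linarith
    _ ≤ K₁ * (2 * (K₃ * (Jl + Jr)) + (Jl + Jr)) := by gcongr
    _ = _ := by ring

/-! ### The estimate in `L²` for complex test functions -/

theorem norm_sq_eq_integral {f : L2R} {φ : ℝ → ℂ} (hf : f =ᵐ[volume] φ) :
    ‖f‖ ^ 2 = ∫ t, ((φ t).re ^ 2 + (φ t).im ^ 2) := by
  have h1 : ((‖f‖ ^ 2 : ℝ) : ℂ) = ((∫ t, ((φ t).re ^ 2 + (φ t).im ^ 2) : ℝ) : ℂ) := by
    rw [Complex.ofReal_pow]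
    refine (inner_self_eq_norm_sq_to_K (𝕜 := ℂ) f).symm.trans ?_
    rw [L2.inner_def, ← integral_complex_ofReal]
    refine integral_congr_ae ?_
    filter_upwards [hf] with t ht
    rw [ht, RCLike.inner_apply, Complex.mul_conj, Complex.normSq_apply]
    push_cast
    ring
  exact_mod_cast h1

theorem IsTestFun.exists_support_subset {φ : ℝ → ℂ} (h : IsTestFun φ) :
    ∃ L : ℝ, 0 ≤ L ∧ tsupport φ ⊆ Set.Ioo (-L) L := by
  obtain ⟨L, hL⟩ := h.2.isBounded.subset_ball_lt 0 0
  exact ⟨L, hL.1.le, by simpa [Real.ball_eq_Ioo] using hL.2⟩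

/-- The coefficients are real, so real and imaginary parts satisfy the real estimate separately; its
constant does not depend on the support. -/
theorem exp_abs_test_estimate {C μ : ℝ} (hC : 0 ≤ C) (hμ : 0 < μ)
    (h0 : jostDeriv C μ 0 0 ≠ 0) (h1 : jostDeriv C μ 1 0 ≠ 0) :
    ∃ K : ℝ, ∀ (φ : ℝ → ℂ) (h : IsTestFun φ) (g : L2R),
      (g =ᵐ[volume] fun t => deriv (deriv φ) t + ((C * Real.exp (-|t|) - μ ^ 2 : ℝ) : ℂ) * φ t) →
      ‖h.toL2‖ ≤ K * ‖g‖ := by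
  obtain ⟨K, hK0, hK⟩ := exists_integral_sq_le_of_jostDeriv_ne_zero hC hμ h0 h1
  refine ⟨√K, fun φ h g hg => ?_⟩
  refine le_of_sq_le_sq ?_ (by positivity)
  rw [mul_pow, Real.sq_sqrt hK0, norm_sq_eq_integral h.coeFn_toL2, norm_sq_eq_integral hg]
  obtain ⟨L, hL0, hL⟩ := h.exists_support_subset
  have hφ0 : ∀ t, t ∉ tsupport φ → φ t = 0 := fun t => image_eq_zero_of_notMem_tsupport
  have hφ1 : ∀ t, t ∉ tsupport φ → deriv φ t = 0 := fun t ht =>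
    Function.notMem_support.mp fun hs => ht (support_deriv_subset hs)
  have hφ2 : ∀ t, t ∉ tsupport φ → deriv (deriv φ) t = 0 := fun t ht =>
    Function.notMem_support.mp fun hs =>
      ht (closure_minimal support_deriv_subset (isClosed_tsupport φ) (support_deriv_subset hs))
  have hout : ∀ t, L ≤ |t| → t ∉ tsupport φ := fun t ht hs =>
    absurd (abs_lt.mpr (hL hs)) ht.not_gt
  have hint : ∀ F : ℝ → ℝ, (∀ t, t ∉ tsupport φ → F t = 0) → ∫ t, F t = ∫ t in -L..L, F t := by
    intro F hF
    refine (intervalIntegral.integral_eq_integral_of_support_subset fun t ht => ?_).symm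
    have h2 : t ∈ tsupport φ := by
      by_contra h3
      exact ht (hF t h3)
    exact Set.Ioo_subset_Ioc_self (hL h2)
  rw [hint _ fun t ht => by simp [hφ0 t ht], hint _ fun t ht => by simp [hφ0 t ht, hφ2 t ht]]
  have hc0 := h.1.continuous
  have hc2 := h.deriv.deriv.1.continuous
  have hre := hK (fun t => (φ t).re) (fun t => (deriv φ t).re) (fun t => (deriv (deriv φ) t).re) L
    hL0 (fun t => Complex.reCLM.hasFDerivAt.comp_hasDerivAt t (h.hasDerivAt t))
    (fun t => Complex.reCLM.hasFDerivAt.comp_hasDerivAt t (h.deriv.hasDerivAt t)) (by fun_prop)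
    (fun t ht => by simp [hφ0 t (hout t ht)]) (fun t ht => by simp [hφ1 t (hout t ht)])
  have him := hK (fun t => (φ t).im) (fun t => (deriv φ t).im) (fun t => (deriv (deriv φ) t).im) L
    hL0 (fun t => Complex.imCLM.hasFDerivAt.comp_hasDerivAt t (h.hasDerivAt t))
    (fun t => Complex.imCLM.hasFDerivAt.comp_hasDerivAt t (h.deriv.hasDerivAt t)) (by fun_prop)
    (fun t ht => by simp [hφ0 t (hout t ht)]) (fun t ht => by simp [hφ1 t (hout t ht)])
  simp only [Complex.add_re, Complex.add_im, Complex.re_ofReal_mul, Complex.im_ofReal_mul]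
  rw [intervalIntegral.integral_add (Continuous.intervalIntegrable (by fun_prop) _ _)
      (Continuous.intervalIntegrable (by fun_prop) _ _),
    intervalIntegral.integral_add (Continuous.intervalIntegrable (by fun_prop) _ _)
      (Continuous.intervalIntegrable (by fun_prop) _ _), mul_add]
  exact add_le_add hre him

/-! ### The potential as a bounded operator, and the resolvent set -/

theorem coeFn_expPotential (C : ℝ) (f : L2R) :
    expPotential C f =ᵐ[volume] fun t => ((C * Real.exp (-|t|) : ℝ) : ℂ) * f t :=
  MemLp.coeFn_toLp (memLp_expPotential_mul C f)

theorem norm_expPotential_le (C : ℝ) (f : L2R) : ‖expPotential C f‖ ≤ |C| * ‖f‖ := by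
  refine Lp.norm_le_mul_norm_of_ae_le_mul ?_
  filter_upwards [coeFn_expPotential C f] with t ht
  have h1 : Real.exp (-|t|) ≤ 1 := Real.exp_le_one_iff.mpr (by simp)
  rw [ht, norm_mul, Complex.norm_real, norm_mul, Real.norm_eq_abs, Real.norm_eq_abs, Real.abs_exp]
  gcongr
  exact mul_le_of_le_one_right (abs_nonneg C) h1

/-- Multiplication by `C e^{-|t|} - l` as a bounded operator. -/
def expPotentialSub (C l : ℝ) : L2R →L[ℂ] L2R :=
  (expPotential C).mkContinuous |C| (norm_expPotential_le C) - (l : ℂ) • ContinuousLinearMap.id ℂ L2R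

theorem expPotentialSub_apply (C l : ℝ) (f : L2R) :
    expPotentialSub C l f = expPotential C f - (l : ℂ) • f := rfl

theorem coeFn_expPotentialSub (C l : ℝ) (f : L2R) :
    expPotentialSub C l f =ᵐ[volume] fun t => ((C * Real.exp (-|t|) - l : ℝ) : ℂ) * f t := by
  rw [expPotentialSub_apply]
  filter_upwards [Lp.coeFn_sub (expPotential C f) ((l : ℂ) • f), coeFn_expPotential C f,
    Lp.coeFn_smul (l : ℂ) f] with t h1 h2 h3
  rw [h1, Pi.sub_apply, h2, h3, Pi.smul_apply, smul_eq_mul]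
  push_cast
  ring

theorem inner_expPotentialSub (C l : ℝ) (y : L2R) {φ : ℝ → ℂ} (h : IsTestFun φ) :
    ⟪y, expPotentialSub C l h.toL2⟫_ℂ = ∫ t, (expPotentialSub C l (star y)) t * φ t := by
  rw [inner_eq_integral_star_mul _ _ (coeFn_expPotentialSub C l h.toL2)]
  refine integral_congr_ae ?_
  filter_upwards [coeFn_expPotentialSub C l (star y), h.coeFn_toL2] with t h1 h2
  rw [h1, h2]
  ring

theorem exists_laplacianAddExp_apply (C : ℝ) (x : (laplacianAddExp C).domain) :
    ∃ g, ((x : L2R), g) ∈ laplacianGraph ∧ laplacianAddExp C x = expPotential C x + g := by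
  refine ⟨laplacianR x, ?_, LinearPMap.vadd_apply _ _ x⟩
  rw [← laplacianR_graph]
  exact laplacianR.mem_graph x

theorem mem_laplacianAddExp_domain (C : ℝ) {x y : L2R} (h : (x, y) ∈ laplacianGraph) :
    x ∈ (laplacianAddExp C).domain :=
  Submodule.mem_map_of_mem (f := LinearMap.fst ℂ L2R L2R) h

/-- The test estimate passes to the closure, which contains all weak solutions by the core property.
It therefore bounds `T - μ²` below on its domain and rules out nonzero vectors orthogonal to the
range, the adjoint equation being the same up to conjugation. -/
theorem mem_unboundedResolventSet_laplacianAddExp {C μ : ℝ} (hC : 0 ≤ C) (hμ : 0 < μ)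
    (h : jostProduct C μ ≠ 0) :
    ((μ ^ 2 : ℝ) : ℂ) ∈ unboundedResolventSet (laplacianAddExp C) := by
  rw [jostProduct_ofReal C hμ, Complex.ofReal_ne_zero, neg_ne_zero, mul_ne_zero_iff] at h
  obtain ⟨K, hK⟩ := exp_abs_test_estimate hC hμ h.1 h.2
  set B := expPotentialSub C (μ ^ 2) with hB
  have hK' : ∀ p ∈ testSecondDerivGraph, ‖p.1‖ ≤ K * ‖p.2 + B p.1‖ := by
    intro p hp
    obtain ⟨φ, hφ, rfl⟩ := exists_of_mem_testSecondDerivGraph hp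
    refine hK φ hφ _ ?_
    filter_upwards [Lp.coeFn_add hφ.deriv.deriv.toL2 (B hφ.toL2),
      coeFn_expPotentialSub C (μ ^ 2) hφ.toL2, hφ.coeFn_toL2, hφ.deriv.deriv.coeFn_toL2]
      with t h1 h2 h3 h4
    rw [h1, Pi.add_apply, hB, h2, h3, h4]
  have hKc : ∀ p ∈ testSecondDerivGraph.topologicalClosure, ‖p.1‖ ≤ K * ‖p.2 + B p.1‖ := by
    intro p hp
    have hcl : IsClosed {q : L2R × L2R | ‖q.1‖ ≤ K * ‖q.2 + B q.1‖} :=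
      isClosed_le (by fun_prop) (by fun_prop)
    exact closure_minimal (fun q hq => hK' q hq) hcl hp
  have hzero : ∀ x : L2R, HasWeakSecondDeriv x (-(B x)) → x = 0 := by
    intro x hx
    have := hKc _ hx.mem_closure_testSecondDerivGraph
    rw [neg_add_cancel, norm_zero, mul_zero] at this
    exact norm_le_zero_iff.mp this
  have hdense : ∀ y : L2R, (∀ p ∈ testSecondDerivGraph, ⟪y, p.2 + B p.1⟫_ℂ = 0) → y = 0 := by
    intro y hy
    exact eq_zero_of_star_eq_zero
      (hzero _ (hasWeakSecondDeriv_of_inner_eq_zero (inner_expPotentialSub C (μ ^ 2) y) hy))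
  have happ : ∀ x : (laplacianAddExp C).domain, ∃ g, ((x : L2R), g) ∈ laplacianGraph ∧
      laplacianAddExp C x - ((μ ^ 2 : ℝ) : ℂ) • (x : L2R) = g + B x := by
    intro x
    obtain ⟨g, hg, he⟩ := exists_laplacianAddExp_apply C x
    refine ⟨g, hg, ?_⟩
    rw [he, hB, expPotentialSub_apply]
    abel
  refine mem_unboundedResolventSet_of_norm_le _ _ K (fun x => ?_) fun y => ?_
  · obtain ⟨g, hg, he⟩ := happ x
    rw [he]
    exact hKc (x, g) hg.2.mem_closure_testSecondDerivGraph
  · obtain ⟨x, hx⟩ := exists_mem_closure_testSecondDerivGraph B hK' hdense y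
    have hx' := closure_testSecondDerivGraph_le hx
    have hdom : x ∈ (laplacianAddExp C).domain := mem_laplacianAddExp_domain C hx'
    obtain ⟨g, hg, he⟩ := happ ⟨x, hdom⟩
    refine ⟨⟨x, hdom⟩, ?_⟩
    have hgy : g - (y - B x) = 0 := laplacianGraph_snd_eq_zero _
      (laplacianGraph.sub_mem hg hx') (sub_self x)
    rw [he, sub_eq_zero.mp hgy, sub_add_cancel]

end

theorem proposition2 (C : ℝ) (hC : 0 < C) :
    {lam : ℝ | 0 < lam ∧ (lam : ℂ) ∈ unboundedSpectrum (laplacianAddExp C)}.Finite := by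
  refine ((finite_setOf_jostProduct_eq_zero C).image fun μ => μ ^ 2).subset ?_
  rintro lam ⟨hlam, hspec⟩
  refine ⟨√lam, ⟨Real.sqrt_pos.mpr hlam, ?_⟩, Real.sq_sqrt hlam.le⟩
  by_contra h
  refine hspec ?_
  have := mem_unboundedResolventSet_laplacianAddExp hC.le (Real.sqrt_pos.mpr hlam) h
  rwa [Real.sq_sqrt hlam.le] at this
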